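/- Let $N>2$ and let $q\in\mathbb C^\times$ be not a root of unity. Label the irreducible finite-dimensional (type 1) representations of $U_q(sl_N)$ by Young diagrams with at most $N-1$ rows; write $[r]$, $r\ge 0$, for the diagram with one row of length $r$ (a symmetric representation) and $\overline{\lambda}$ for the diagram of the dual representation of $\lambda$. A 6-j symbol $$\left\{\begin{matrix} R_1&R_2&X\\ R_3&R_4&Y\end{matrix}\right\}$$ is an array of such diagrams for which the multiplicity spaces of $X$ in $R_1\otimes R_2$, of $R_4$ in $X\otimes R_3$, of $Y$ in $R_2\otimes R_3$ and of $R_4$ in $R_1\otimes Y$ are all nonzero. It is called trivial if $X$ and $Y$ are the only possible values for the given $R_1,R_2,R_3,R_4$. An array is of type I if it has the form $\left\{\begin{matrix}[r_1]&\overline{[r_2]}&X\\ [r_3]&[r_4]&Y\end{matrix}\right\}$, and of type II if it has the form $\left\{\begin{matrix}[r_1]&[r_2]&X\\ \overline{[r_3]}&[r_4]&Y\end{matrix}\right\}$. The tetrahedral symmetries are generated by $$\left\{\begin{matrix}\lambda_1&\lambda_2&\mu\\ \lambda_3&\lambda_4&\nu\end{matrix}\right\}\leftrightarrow\left\{\begin{matrix}\overline{\lambda_3}&\overline{\lambda_2}&\overline{\nu}\\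 \overline{\lambda_1}&\overline{\lambda_4}&\overline{\mu}\end{matrix}\right\},\ \left\{\begin{matrix}\lambda_3&\overline{\lambda_4}&\overline{\mu}\\ \lambda_1&\overline{\lambda_2}&\overline{\nu}\end{matrix}\right\},\ \left\{\begin{matrix}\lambda_1&\overline{\mu}&\overline{\lambda_2}\\ \overline{\lambda_3}&\overline{\nu}&\overline{\lambda_4}\end{matrix}\right\},\ \left\{\begin{matrix}\lambda_2&\lambda_1&\mu\\ \overline{\lambda_4}&\overline{\lambda_3}&\overline{\nu}\end{matrix}\right\},$$ and conjugation replaces all six entries by their conjugates. (1) Every 6-j symbol in which each of $R_1,R_2,R_3,R_4$ is symmetric or conjugate to symmetric is either trivial, or is carried by a composition of tetrahedral symmetries and conjugation to an array of type I or of type II. (2) The two types are not related to each other: if a 6-j symbol is nontrivial, of one of the two types, and at least one of its entries $X,Y$ is neither symmetric nor conjugate to symmetric, then no composition of tetrahedral symmetries and conjugation carries it to an array of the other type. -/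

import Mathlib

open scoped TensorProduct

/-- Generators of `U_q(sl_N)`: Chevalley generators `E i`, `F i`, and the Cartan generators `K i`
together with their inverses `L i`, one for every simple root `i : Fin (N - 1)`. -/
inductive UqGen (N : ℕ) : Type
  | E (i : Fin (N - 1)) : UqGen N
  | F (i : Fin (N - 1)) : UqGen N
  | K (i : Fin (N - 1)) : UqGen N
  | L (i : Fin (N - 1)) : UqGen N

/-- Two simple roots of `sl_N` are neighbours in the Dynkin diagram `A_{N-1}`. -/
def AdjRoots {N : ℕ} (i j : Fin (N - 1)) : Prop :=
  i.val + 1 = j.val ∨ j.val + 1 = i.val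

instance {N : ℕ} (i j : Fin (N - 1)) : Decidable (AdjRoots i j) :=
  inferInstanceAs (Decidable (_ ∨ _))

/-- The Cartan matrix of `sl_N`. -/
def cartanA {N : ℕ} (i j : Fin (N - 1)) : ℤ :=
  if i = j then 2 else if AdjRoots i j then -1 else 0

/-- A power of `q` (with integer exponent), as a complex number. -/
def qpow (q : ℂˣ) (a : ℤ) : ℂ := ((q ^ a : ℂˣ) : ℂ)

/-- The quantum Serre expression `x² y - (q + q⁻¹) x y x + y x²`. -/
noncomputable def serre {A : Type*} [Ring A] [Algebra ℂ A] (q : ℂˣ) (x y : A) : A :=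
  x * x * y - (qpow q 1 + qpow q (-1)) • (x * y * x) + y * x * x

/-- The generator `g`, as an element of the free algebra. -/
noncomputable abbrev fgen {N : ℕ} (g : UqGen N) : FreeAlgebra ℂ (UqGen N) := FreeAlgebra.ι ℂ g

open UqGen in
/-- The defining relations of the Drinfeld–Jimbo algebra `U_q(sl_N)`. -/
inductive UqRel (N : ℕ) (q : ℂˣ) : FreeAlgebra ℂ (UqGen N) → FreeAlgebra ℂ (UqGen N) → Prop
  | KL (i) : UqRel N q (fgen (K i) * fgen (L i)) 1
  | LK (i) : UqRel N q (fgen (L i) * fgen (K i)) 1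
  | KK (i j) : UqRel N q (fgen (K i) * fgen (K j)) (fgen (K j) * fgen (K i))
  | KE (i j) : UqRel N q (fgen (K i) * fgen (E j)) (qpow q (cartanA i j) • (fgen (E j) * fgen (K i)))
  | KF (i j) : UqRel N q (fgen (K i) * fgen (F j)) (qpow q (-cartanA i j) • (fgen (F j) * fgen (K i)))
  | EF (i) : UqRel N q (fgen (E i) * fgen (F i) - fgen (F i) * fgen (E i))
      ((qpow q 1 - qpow q (-1))⁻¹ • (fgen (K i) - fgen (L i)))
  | EF_ne (i j) (h : i ≠ j) : UqRel N q (fgen (E i) * fgen (F j)) (fgen (F j) * fgen (E i))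
  | EE (i j) (h : i ≠ j) (h' : ¬ AdjRoots i j) :
      UqRel N q (fgen (E i) * fgen (E j)) (fgen (E j) * fgen (E i))
  | FF (i j) (h : i ≠ j) (h' : ¬ AdjRoots i j) :
      UqRel N q (fgen (F i) * fgen (F j)) (fgen (F j) * fgen (F i))
  | serreE (i j) (h : AdjRoots i j) : UqRel N q (serre q (fgen (E i)) (fgen (E j))) 0
  | serreF (i j) (h : AdjRoots i j) : UqRel N q (serre q (fgen (F i)) (fgen (F j))) 0

/-- The quantum group `U_q(sl_N)`, as an associative unital algebra over `ℂ`. -/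
abbrev Uq (N : ℕ) (q : ℂˣ) : Type := RingQuot (UqRel N q)

/-- The generator `g`, as an element of `U_q(sl_N)`. -/
noncomputable def Uq.gen {N : ℕ} (q : ℂˣ) (g : UqGen N) : Uq N q :=
  RingQuot.mkAlgHom ℂ (UqRel N q) (fgen g)

/-! ### The relations between the generators -/

theorem qpow_add (q : ℂˣ) (a b : ℤ) : qpow q (a + b) = qpow q a * qpow q b := by
  simp [qpow, zpow_add]

theorem qpow_zero (q : ℂˣ) : qpow q 0 = 1 := by simp [qpow]

theorem qpow_mul_neg (q : ℂˣ) (a : ℤ) : qpow q a * qpow q (-a) = 1 := by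
  rw [← qpow_add, add_neg_cancel, qpow_zero]

theorem map_serre {A B : Type*} [Ring A] [Algebra ℂ A] [Ring B] [Algebra ℂ B] (q : ℂˣ)
    (f : A →ₐ[ℂ] B) (x y : A) : f (serre q x y) = serre q (f x) (f y) := by
  simp only [serre, map_add, map_sub, map_mul, map_smul]

namespace Uq

open UqGen

variable {N : ℕ} {q : ℂˣ}

theorem rel_map {a b : FreeAlgebra ℂ (UqGen N)} (h : UqRel N q a b) :
    RingQuot.mkAlgHom ℂ (UqRel N q) a = RingQuot.mkAlgHom ℂ (UqRel N q) b :=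
  RingQuot.mkAlgHom_rel ℂ h

theorem K_mul_L (i : Fin (N - 1)) : gen q (K i) * gen q (L i) = 1 := by
  simpa [gen] using rel_map (UqRel.KL (q := q) i)

theorem L_mul_K (i : Fin (N - 1)) : gen q (L i) * gen q (K i) = 1 := by
  simpa [gen] using rel_map (UqRel.LK (q := q) i)

theorem K_mul_K (i j : Fin (N - 1)) : gen q (K i) * gen q (K j) = gen q (K j) * gen q (K i) := by
  simpa [gen] using rel_map (UqRel.KK (q := q) i j)

theorem K_mul_E (i j : Fin (N - 1)) :
    gen q (K i) * gen q (E j) = qpow q (cartanA i j) • (gen q (E j) * gen q (K i)) := by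
  simpa [gen] using rel_map (UqRel.KE (q := q) i j)

theorem K_mul_F (i j : Fin (N - 1)) :
    gen q (K i) * gen q (F j) = qpow q (-cartanA i j) • (gen q (F j) * gen q (K i)) := by
  simpa [gen] using rel_map (UqRel.KF (q := q) i j)

theorem E_F_self (i : Fin (N - 1)) :
    gen q (E i) * gen q (F i) - gen q (F i) * gen q (E i) =
      (qpow q 1 - qpow q (-1))⁻¹ • (gen q (K i) - gen q (L i)) := by
  simpa [gen] using rel_map (UqRel.EF (q := q) i)

theorem E_mul_F_of_ne (i j : Fin (N - 1)) (h : i ≠ j) :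
    gen q (E i) * gen q (F j) = gen q (F j) * gen q (E i) := by
  simpa [gen] using rel_map (UqRel.EF_ne (q := q) i j h)

theorem E_mul_E (i j : Fin (N - 1)) (h : i ≠ j) (h' : ¬ AdjRoots i j) :
    gen q (E i) * gen q (E j) = gen q (E j) * gen q (E i) := by
  simpa [gen] using rel_map (UqRel.EE (q := q) i j h h')

theorem F_mul_F (i j : Fin (N - 1)) (h : i ≠ j) (h' : ¬ AdjRoots i j) :
    gen q (F i) * gen q (F j) = gen q (F j) * gen q (F i) := by
  simpa [gen] using rel_map (UqRel.FF (q := q) i j h h')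

theorem serre_E (i j : Fin (N - 1)) (h : AdjRoots i j) :
    serre q (gen q (E i)) (gen q (E j)) = 0 := by
  have := rel_map (UqRel.serreE (q := q) i j h)
  rw [map_serre, map_zero] at this
  exact this

theorem serre_F (i j : Fin (N - 1)) (h : AdjRoots i j) :
    serre q (gen q (F i)) (gen q (F j)) = 0 := by
  have := rel_map (UqRel.serreF (q := q) i j h)
  rw [map_serre, map_zero] at this
  exact this

theorem L_mul_E (i j : Fin (N - 1)) :
    gen q (L i) * gen q (E j) = qpow q (-cartanA i j) • (gen q (E j) * gen q (L i)) := by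
  have h := congrArg (fun t => gen q (L i) * t * gen q (L i)) (K_mul_E (q := q) i j)
  simp only [mul_smul_comm, smul_mul_assoc] at h
  rw [show gen q (L i) * (gen q (K i) * gen q (E j)) * gen q (L i)
      = (gen q (L i) * gen q (K i)) * gen q (E j) * gen q (L i) by simp only [mul_assoc],
    show gen q (L i) * (gen q (E j) * gen q (K i)) * gen q (L i)
      = gen q (L i) * gen q (E j) * (gen q (K i) * gen q (L i)) by simp only [mul_assoc],
    L_mul_K, K_mul_L, one_mul, mul_one] at h
  rw [h, smul_smul, mul_comm, qpow_mul_neg, one_smul]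

theorem L_mul_F (i j : Fin (N - 1)) :
    gen q (L i) * gen q (F j) = qpow q (cartanA i j) • (gen q (F j) * gen q (L i)) := by
  have h := congrArg (fun t => gen q (L i) * t * gen q (L i)) (K_mul_F (q := q) i j)
  simp only [mul_smul_comm, smul_mul_assoc] at h
  rw [show gen q (L i) * (gen q (K i) * gen q (F j)) * gen q (L i)
      = (gen q (L i) * gen q (K i)) * gen q (F j) * gen q (L i) by simp only [mul_assoc],
    show gen q (L i) * (gen q (F j) * gen q (K i)) * gen q (L i)
      = gen q (L i) * gen q (F j) * (gen q (K i) * gen q (L i)) by simp only [mul_assoc],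
    L_mul_K, K_mul_L, one_mul, mul_one] at h
  rw [h, smul_smul, qpow_mul_neg, one_smul]

theorem L_mul_L (i j : Fin (N - 1)) : gen q (L i) * gen q (L j) = gen q (L j) * gen q (L i) := by
  have h1 : (gen q (L i) * gen q (L j)) * (gen q (K i) * gen q (K j)) = 1 := by
    rw [K_mul_K, mul_assoc, ← mul_assoc (gen q (L j)), L_mul_K, one_mul, L_mul_K]
  have h2 : (gen q (K i) * gen q (K j)) * (gen q (L j) * gen q (L i)) = 1 := by
    rw [mul_assoc, ← mul_assoc (gen q (K j)), K_mul_L, one_mul, K_mul_L]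
  exact left_inv_eq_right_inv h1 h2

theorem K_mul_L_comm (i j : Fin (N - 1)) :
    gen q (K i) * gen q (L j) = gen q (L j) * gen q (K i) := by
  calc gen q (K i) * gen q (L j)
      = gen q (L j) * (gen q (K j) * gen q (K i)) * gen q (L j) := by
        rw [← mul_assoc, L_mul_K, one_mul]
    _ = gen q (L j) * (gen q (K i) * (gen q (K j) * gen q (L j))) := by
        rw [K_mul_K j i, mul_assoc, mul_assoc]
    _ = gen q (L j) * gen q (K i) := by rw [K_mul_L, mul_one]

end Uq

theorem cartanA_symm {N : ℕ} (i j : Fin (N - 1)) : cartanA i j = cartanA j i := by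
  unfold cartanA AdjRoots
  by_cases h : i = j
  · simp [h]
  · have h' : ¬ j = i := fun e => h e.symm
    simp only [h, h', if_false, or_comm (a := i.val + 1 = j.val)]
    congr

theorem cartanA_self {N : ℕ} (i : Fin (N - 1)) : cartanA i i = 2 := by simp [cartanA]

theorem cartanA_adj {N : ℕ} {i j : Fin (N - 1)} (h : AdjRoots i j) : cartanA i j = -1 := by
  have : i ≠ j := by
    rintro rfl
    unfold AdjRoots at h
    omega
  simp [cartanA, this, h]

theorem cartanA_far {N : ℕ} {i j : Fin (N - 1)} (h : i ≠ j) (h' : ¬ AdjRoots i j) :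
    cartanA i j = 0 := by
  simp [cartanA, h, h']

/-- The quantum Serre relation is additive on `q`-commuting families. -/
theorem serre_add {A : Type*} [Ring A] [Algebra ℂ A] (q : ℂˣ) (e : ℤ) (he : e = 1 ∨ e = -1)
    (x y z w : A)
    (h1 : y * x = qpow q (-2 * e) • (x * y)) (h2 : y * z = qpow q e • (z * y))
    (h3 : w * x = qpow q e • (x * w)) (hx : serre q x z = 0) (hy : serre q y w = 0) :
    serre q (x + y) (z + w) = 0 := by
  obtain ⟨a, b, hab, ha, hb, hs⟩ : ∃ a b : ℂ, a * b = 1 ∧ qpow q e = a ∧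
      qpow q (-2 * e) = b * b ∧ qpow q 1 + qpow q (-1) = a + b := by
    refine ⟨qpow q e, qpow q (-e), qpow_mul_neg q e, rfl, ?_, ?_⟩
    · rw [← qpow_add]
      congr 1
      ring
    · rcases he with rfl | rfl
      · rfl
      · rw [neg_neg, add_comm]
  simp only [serre, ha, hb, hs] at *
  have e1 : x * y * z = a • (x * z * y) := by rw [mul_assoc, h2, mul_smul_comm, mul_assoc]
  have e2 : y * x * z = b • (x * z * y) := by
    rw [h1, smul_mul_assoc, e1, smul_smul]
    congr 1
    linear_combination b * hab
  have e3 : z * y * x = (b * b) • (z * x * y) := by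
    rw [mul_assoc, h1, mul_smul_comm, mul_assoc]
  have e4 : y * z * x = b • (z * x * y) := by
    rw [h2, smul_mul_assoc, e3, smul_smul]
    congr 1
    linear_combination b * hab
  have e5 : y * y * z = (a * a) • (z * y * y) := by
    rw [mul_assoc, h2, mul_smul_comm, ← mul_assoc, h2, smul_mul_assoc, smul_smul]
  have e6 : y * z * y = a • (z * y * y) := by rw [h2, smul_mul_assoc]
  have f1 : w * x * x = (a * a) • (x * x * w) := by
    rw [h3, smul_mul_assoc, mul_assoc, h3, mul_smul_comm, smul_smul, mul_assoc]
  have f2 : x * w * x = a • (x * x * w) := by rw [mul_assoc, h3, mul_smul_comm, mul_assoc]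
  have f3 : w * x * y = a • (x * w * y) := by rw [h3, smul_mul_assoc]
  have f4 : y * x * w = (b * b) • (x * y * w) := by rw [h1, smul_mul_assoc]
  have f5 : w * y * x = b • (x * w * y) := by
    rw [mul_assoc, h1, mul_smul_comm, ← mul_assoc, f3, smul_smul]
    congr 1
    linear_combination b * hab
  have f6 : y * w * x = b • (x * y * w) := by
    rw [mul_assoc, h3, mul_smul_comm, ← mul_assoc, f4, smul_smul]
    congr 1
    linear_combination b * hab
  have key : (x + y) * (x + y) * (z + w) - (a + b) • ((x + y) * (z + w) * (x + y)) +
      (z + w) * (x + y) * (x + y) =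
      (x * x * z - (a + b) • (x * z * x) + z * x * x) +
      (y * y * w - (a + b) • (y * w * y) + w * y * y) +
      ((1 - a * b) • (x * x * w) + (1 - a * b) • (z * y * y) + (1 - a * b) • (z * x * y)
        + (1 - a * b) • (x * y * w)) := by
    simp only [add_mul, mul_add, e1, e2, e3, e4, e5, e6, f1, f2, f3, f4, f5, f6]
    module
  rw [key, hx, hy, hab]
  simp

/-! ### The coproduct -/

open UqGen Uq in
/-- The coproduct on the generators:
`E i ↦ E i ⊗ K i + 1 ⊗ E i`, `F i ↦ F i ⊗ 1 + (K i)⁻¹ ⊗ F i`, `(K i)^{±1} ↦ (K i)^{±1} ⊗ (K i)^{±1}`. -/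
noncomputable def comulGen (N : ℕ) (q : ℂˣ) : UqGen N → Uq N q ⊗[ℂ] Uq N q
  | E i => gen q (E i) ⊗ₜ gen q (K i) + 1 ⊗ₜ gen q (E i)
  | F i => gen q (F i) ⊗ₜ 1 + gen q (L i) ⊗ₜ gen q (F i)
  | K i => gen q (K i) ⊗ₜ gen q (K i)
  | L i => gen q (L i) ⊗ₜ gen q (L i)

section comul

open UqGen Uq

variable {N : ℕ} {q : ℂˣ}

theorem comulGen_serreE (i j : Fin (N - 1)) (h : AdjRoots i j) :
    serre q (comulGen N q (E i)) (comulGen N q (E j)) = 0 := by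
  have hc : cartanA i j = -1 := cartanA_adj h
  have hc' : cartanA j i = -1 := by rw [cartanA_symm, hc]
  have hE : ∀ a b : Fin (N - 1), ∀ c : ℤ, cartanA a b = c →
      gen q (E b) * gen q (K a) = qpow q (-c) • (gen q (K a) * gen q (E b)) := by
    rintro a b c rfl
    rw [K_mul_E, smul_smul, mul_comm, qpow_mul_neg, one_smul]
  refine serre_add q 1 (Or.inl rfl) _ _ _ _ ?_ ?_ ?_ ?_ ?_
  · simp only [Algebra.TensorProduct.tmul_mul_tmul, one_mul, mul_one,
      hE i i 2 (cartanA_self i), TensorProduct.tmul_smul]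
  · simp only [Algebra.TensorProduct.tmul_mul_tmul, one_mul, mul_one,
      hE j i (-1) hc', TensorProduct.tmul_smul, neg_neg]
  · simp only [Algebra.TensorProduct.tmul_mul_tmul, one_mul, mul_one,
      hE i j (-1) hc, TensorProduct.tmul_smul, neg_neg]
  · have h1 : gen q (K i) * gen q (K j) * gen q (K i) = gen q (K i) * gen q (K i) * gen q (K j) := by
      rw [mul_assoc, K_mul_K j i, mul_assoc]
    have h2 : gen q (K j) * gen q (K i) * gen q (K i) = gen q (K i) * gen q (K i) * gen q (K j) := by
      rw [K_mul_K j i, h1]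
    have h3 := congrArg (fun t => t ⊗ₜ[ℂ] (gen q (K i) * gen q (K i) * gen q (K j)))
      (serre_E (q := q) i j h)
    simp only [serre, TensorProduct.add_tmul, TensorProduct.sub_tmul,
      TensorProduct.zero_tmul] at h3
    simp only [serre, Algebra.TensorProduct.tmul_mul_tmul, h1, h2, TensorProduct.smul_tmul']
    exact h3
  · have h3 := congrArg (fun t => (1 : Uq N q) ⊗ₜ[ℂ] t) (serre_E (q := q) i j h)
    simp only [serre, TensorProduct.tmul_add, TensorProduct.tmul_sub, TensorProduct.tmul_smul,
      TensorProduct.tmul_zero] at h3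
    simpa only [serre, Algebra.TensorProduct.tmul_mul_tmul, one_mul] using h3

theorem comulGen_serreF (i j : Fin (N - 1)) (h : AdjRoots i j) :
    serre q (comulGen N q (F i)) (comulGen N q (F j)) = 0 := by
  have hc : cartanA i j = -1 := cartanA_adj h
  have hc' : cartanA j i = -1 := by rw [cartanA_symm, hc]
  refine serre_add q (-1) (Or.inr rfl) _ _ _ _ ?_ ?_ ?_ ?_ ?_
  · simp only [Algebra.TensorProduct.tmul_mul_tmul, one_mul, mul_one,
      L_mul_F, cartanA_self, TensorProduct.smul_tmul']
    norm_num
  · simp only [Algebra.TensorProduct.tmul_mul_tmul, one_mul, mul_one,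
      L_mul_F, hc, TensorProduct.smul_tmul']
  · simp only [Algebra.TensorProduct.tmul_mul_tmul, one_mul, mul_one,
      L_mul_F, hc', TensorProduct.smul_tmul']
  · have h3 := congrArg (fun t => t ⊗ₜ[ℂ] (1 : Uq N q)) (serre_F (q := q) i j h)
    simp only [serre, TensorProduct.add_tmul, TensorProduct.sub_tmul, ← TensorProduct.smul_tmul',
      TensorProduct.zero_tmul] at h3
    simpa only [serre, Algebra.TensorProduct.tmul_mul_tmul, one_mul] using h3
  · have h1 : gen q (L i) * gen q (L j) * gen q (L i) = gen q (L i) * gen q (L i) * gen q (L j) := by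
      rw [mul_assoc, L_mul_L j i, mul_assoc]
    have h2 : gen q (L j) * gen q (L i) * gen q (L i) = gen q (L i) * gen q (L i) * gen q (L j) := by
      rw [L_mul_L j i, h1]
    have h3 := congrArg (fun t => (gen q (L i) * gen q (L i) * gen q (L j)) ⊗ₜ[ℂ] t)
      (serre_F (q := q) i j h)
    simp only [serre, TensorProduct.tmul_add, TensorProduct.tmul_sub, TensorProduct.tmul_smul,
      TensorProduct.tmul_zero] at h3
    simp only [serre, Algebra.TensorProduct.tmul_mul_tmul, h1, h2]
    exact h3

theorem comulGen_EF_mid (i j : Fin (N - 1)) :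
    (gen q (E i) * gen q (L j)) ⊗ₜ[ℂ] (gen q (K i) * gen q (F j)) =
      (gen q (L j) * gen q (E i)) ⊗ₜ[ℂ] (gen q (F j) * gen q (K i)) := by
  rw [L_mul_E, K_mul_F, TensorProduct.tmul_smul, ← TensorProduct.smul_tmul', cartanA_symm]

theorem comulGen_EF (i j : Fin (N - 1)) :
    comulGen N q (E i) * comulGen N q (F j) - comulGen N q (F j) * comulGen N q (E i) =
      (gen q (E i) * gen q (F j) - gen q (F j) * gen q (E i)) ⊗ₜ gen q (K i) +
      gen q (L j) ⊗ₜ (gen q (E i) * gen q (F j) - gen q (F j) * gen q (E i)) := by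
  simp only [comulGen, add_mul, mul_add, Algebra.TensorProduct.tmul_mul_tmul, one_mul, mul_one,
    comulGen_EF_mid, TensorProduct.tmul_sub, TensorProduct.sub_tmul]
  abel

theorem comulGen_rel {a b : FreeAlgebra ℂ (UqGen N)} (h : UqRel N q a b) :
    FreeAlgebra.lift ℂ (comulGen N q) a = FreeAlgebra.lift ℂ (comulGen N q) b := by
  induction h with
  | KL i => simp [comulGen, K_mul_L, Algebra.TensorProduct.one_def]
  | LK i => simp [comulGen, L_mul_K, Algebra.TensorProduct.one_def]
  | KK i j => simp [comulGen, K_mul_K i j]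
  | KE i j =>
    simp [comulGen, mul_add, add_mul, K_mul_E i j, K_mul_K i j, TensorProduct.smul_tmul']
  | KF i j =>
    simp [comulGen, mul_add, add_mul, K_mul_F i j, K_mul_L_comm i j, TensorProduct.smul_tmul']
  | EF i =>
    simp only [map_sub, map_mul, map_smul, FreeAlgebra.lift_ι_apply, comulGen_EF, E_F_self]
    simp only [comulGen, TensorProduct.tmul_sub, TensorProduct.sub_tmul, TensorProduct.tmul_smul,
      ← TensorProduct.smul_tmul']
    rw [smul_sub, smul_sub, smul_sub]
    abel
  | EF_ne i j h =>
    have := comulGen_EF (q := q) i j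
    rw [E_mul_F_of_ne i j h] at this
    simp only [sub_self, TensorProduct.zero_tmul, TensorProduct.tmul_zero, add_zero] at this
    simpa only [map_mul, FreeAlgebra.lift_ι_apply] using sub_eq_zero.mp this
  | EE i j h h' =>
    have hc : cartanA i j = 0 := cartanA_far h h'
    have hc' : cartanA j i = 0 := by rw [cartanA_symm, hc]
    have e1 : gen q (K i) * gen q (E j) = gen q (E j) * gen q (K i) := by
      rw [K_mul_E, hc, qpow_zero, one_smul]
    have e2 : gen q (K j) * gen q (E i) = gen q (E i) * gen q (K j) := by
      rw [K_mul_E, hc', qpow_zero, one_smul]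
    simp only [map_mul, FreeAlgebra.lift_ι_apply, comulGen, mul_add, add_mul,
      Algebra.TensorProduct.tmul_mul_tmul, one_mul, mul_one, e1, e2, E_mul_E i j h h',
      K_mul_K i j]
    abel
  | FF i j h h' =>
    have hc : cartanA i j = 0 := cartanA_far h h'
    have hc' : cartanA j i = 0 := by rw [cartanA_symm, hc]
    have e1 : gen q (L i) * gen q (F j) = gen q (F j) * gen q (L i) := by
      rw [L_mul_F, hc, qpow_zero, one_smul]
    have e2 : gen q (L j) * gen q (F i) = gen q (F i) * gen q (L j) := by
      rw [L_mul_F, hc', qpow_zero, one_smul]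
    simp only [map_mul, FreeAlgebra.lift_ι_apply, comulGen, mul_add, add_mul,
      Algebra.TensorProduct.tmul_mul_tmul, one_mul, mul_one, e1, e2, F_mul_F i j h h',
      L_mul_L i j]
    abel
  | serreE i j h =>
    have h0 := comulGen_serreE (q := q) i j h
    simp only [serre] at h0
    simpa only [serre, map_add, map_sub, map_mul, map_smul, map_zero, FreeAlgebra.lift_ι_apply]
      using h0
  | serreF i j h =>
    have h0 := comulGen_serreF (q := q) i j h
    simp only [serre] at h0
    simpa only [serre, map_add, map_sub, map_mul, map_smul, map_zero, FreeAlgebra.lift_ι_apply]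
      using h0

/-- The coproduct `Δ : U_q(sl_N) → U_q(sl_N) ⊗ U_q(sl_N)`. -/
noncomputable def comul (N : ℕ) (q : ℂˣ) : Uq N q →ₐ[ℂ] Uq N q ⊗[ℂ] Uq N q :=
  RingQuot.liftAlgHom ℂ ⟨FreeAlgebra.lift ℂ (comulGen N q), fun _ _ h => comulGen_rel h⟩

theorem comul_gen (g : UqGen N) : comul N q (gen q g) = comulGen N q g := by
  simp [comul, gen]

end comul

/-! ### Representations, tensor products and multiplicity spaces -/

/-- A representation of `U_q(sl_N)` on a complex vector space. -/
structure UqRep (N : ℕ) (q : ℂˣ) where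
  V : Type
  [addCommGroup : AddCommGroup V]
  [module : Module ℂ V]
  ρ : Uq N q →ₐ[ℂ] Module.End ℂ V

attribute [instance] UqRep.addCommGroup UqRep.module

namespace UqRep

variable {N : ℕ} {q : ℂˣ}

/-- The action of `U_q(sl_N)` on a tensor product, through the coproduct. -/
noncomputable def tensorAction {V W : Type} [AddCommGroup V] [Module ℂ V] [AddCommGroup W]
    [Module ℂ W] (ρ : Uq N q →ₐ[ℂ] Module.End ℂ V) (σ : Uq N q →ₐ[ℂ] Module.End ℂ W) :
    Uq N q →ₐ[ℂ] Module.End ℂ (V ⊗[ℂ] W) :=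
  (Module.endTensorEndAlgHom (R := ℂ) (A := ℂ) (M := V) (N := W)).comp
    ((Algebra.TensorProduct.map ρ σ).comp (comul N q))

/-- The tensor product of two representations. -/
noncomputable def tensor (A B : UqRep N q) : UqRep N q where
  V := A.V ⊗[ℂ] B.V
  ρ := tensorAction A.ρ B.ρ

/-- The space `Hom_{U_q(sl_N)}(A, B)` of intertwining maps. -/
def intertwiners (A B : UqRep N q) : Submodule ℂ (A.V →ₗ[ℂ] B.V) where
  carrier := {f | ∀ u : Uq N q, f ∘ₗ A.ρ u = B.ρ u ∘ₗ f}
  add_mem' {f g} hf hg u := by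
    rw [LinearMap.add_comp, LinearMap.comp_add, hf u, hg u]
  zero_mem' u := by
    rw [LinearMap.zero_comp, LinearMap.comp_zero]
  smul_mem' c f hf u := by
    rw [LinearMap.smul_comp, LinearMap.comp_smul, hf u]

/-- The multiplicity space `M_C^{A,B} = Hom(C, A ⊗ B)` of `C` in the tensor product `A ⊗ B`. -/
noncomputable def multiplicitySpace (A B C : UqRep N q) :
    Submodule ℂ (C.V →ₗ[ℂ] (A.tensor B).V) :=
  intertwiners C (A.tensor B)

/-- Irreducibility: `V` is nonzero and has no invariant subspace besides `0` and `V`. -/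
def IsIrreducible (A : UqRep N q) : Prop :=
  Nontrivial A.V ∧
    ∀ W : Submodule ℂ A.V, (∀ (u : Uq N q), ∀ v ∈ W, A.ρ u v ∈ W) → W = ⊥ ∨ W = ⊤

end UqRep

/-! ### Young diagrams -/

/-- Young diagrams with at most `N - 1` rows, given by their weakly decreasing row lengths (the
`N`-th row is empty). They label the irreducible representations of `U_q(sl_N)`. -/
@[ext]
structure Diagram (N : ℕ) where
  row : Fin N → ℕ
  anti : Antitone row
  last : ∀ i : Fin N, i.val + 1 = N → row i = 0

namespace Diagram

variable {N : ℕ}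

/-- The conjugate diagram, of the dual representation: the complement of `lam` in the rectangle with
`N` rows of length `lam.row 0`, rotated by half a turn. -/
def conj (lam : Diagram N) : Diagram N where
  row i := lam.row ⟨0, i.pos⟩ - lam.row i.rev
  anti i j h := Nat.sub_le_sub_left (lam.anti (Fin.rev_le_rev.mpr h)) _
  last i h := by
    have : i.rev = ⟨0, i.pos⟩ := by
      apply Fin.ext
      rw [Fin.val_rev]
      simp only
      omega
    rw [this, Nat.sub_self]

/-- `lam` is symmetric: it is a diagram `[r]` with at most one row, `r ≥ 0`. -/
def IsSymmetric (lam : Diagram N) : Prop := ∀ i : Fin N, 0 < i.val → lam.row i = 0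

/-- `lam` is conjugate to symmetric: it is the conjugate of a diagram `[r]`. -/
def IsConjSymmetric (lam : Diagram N) : Prop := ∃ mu : Diagram N, mu.IsSymmetric ∧ lam = mu.conj

/-- A diagram that is symmetric or conjugate to symmetric. -/
def IsSymOrConj (lam : Diagram N) : Prop := lam.IsSymmetric ∨ lam.IsConjSymmetric

/-- The Dynkin label of `lam` at the simple root `i`: the difference of two consecutive rows. -/
def dynkin (lam : Diagram N) (i : Fin (N - 1)) : ℕ :=
  lam.row ⟨i.val, by omega⟩ - lam.row ⟨i.val + 1, by omega⟩

end Diagram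

open UqGen Uq in
/-- `A` is an irreducible finite-dimensional representation (of type 1) with the Young diagram
`lam`: its highest weight vector `v` satisfies `E i v = 0` and `K i v = q ^ (lam_i - lam_{i+1}) v`.
For `q` not a root of unity there is exactly one such `A`, up to isomorphism. -/
def UqRep.IsIrrep {N : ℕ} {q : ℂˣ} (A : UqRep N q) (lam : Diagram N) : Prop :=
  A.IsIrreducible ∧ FiniteDimensional ℂ A.V ∧
    ∃ v : A.V, v ≠ 0 ∧ ∀ i : Fin (N - 1),
      A.ρ (gen q (E i)) v = 0 ∧ A.ρ (gen q (K i)) v = (q : ℂ) ^ lam.dynkin i • v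

/-- `nu` occurs in `lam ⊗ mu`: the multiplicity space of the irreducible representation `nu` in the
tensor product of the irreducible representations `lam` and `mu` is not zero. -/
def Occurs {N : ℕ} (q : ℂˣ) (nu lam mu : Diagram N) : Prop :=
  ∃ A B C : UqRep N q, A.IsIrrep lam ∧ B.IsIrrep mu ∧ C.IsIrrep nu ∧
    UqRep.multiplicitySpace A B C ≠ ⊥

/-! ### 6-j symbols -/

/-- The array of entries of a 6-j symbol, with rows `R₁ R₂ X` and `R₃ R₄ Y`. -/
@[ext]
structure SixJ (N : ℕ) where
  R₁ : Diagram N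
  R₂ : Diagram N
  X : Diagram N
  R₃ : Diagram N
  R₄ : Diagram N
  Y : Diagram N

namespace SixJ

variable {N : ℕ}

/-- The array is the array of a 6-j symbol of `U_q(sl_N)`: the Racah matrix
`⨁_X M_X^{R₁,R₂} ⊗ M_{R₄}^{X,R₃} → ⨁_Y M_{R₄}^{R₁,Y} ⊗ M_Y^{R₂,R₃}` has an entry at `(X, Y)`, that
is, the four multiplicity spaces are nonzero. -/
def Exists (q : ℂˣ) (s : SixJ N) : Prop :=
  Occurs q s.X s.R₁ s.R₂ ∧ Occurs q s.R₄ s.X s.R₃ ∧ Occurs q s.R₄ s.R₁ s.Y ∧ Occurs q s.Y s.R₂ s.R₃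

/-- The 6-j symbol is trivial: `X` and `Y` are the only possible values for the given
`R₁, R₂, R₃, R₄`. -/
def IsTrivial (q : ℂˣ) (s : SixJ N) : Prop :=
  ∀ X' Y' : Diagram N, Exists q { s with X := X', Y := Y' } → X' = s.X ∧ Y' = s.Y

/-- `R₁, R₂, R₃, R₄` are symmetric or conjugate to symmetric. -/
def HasSymmetricEntries (s : SixJ N) : Prop :=
  s.R₁.IsSymOrConj ∧ s.R₂.IsSymOrConj ∧ s.R₃.IsSymOrConj ∧ s.R₄.IsSymOrConj

/-- Type I: only `R₂` is conjugated. -/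
def IsTypeI (s : SixJ N) : Prop :=
  s.R₁.IsSymmetric ∧ s.R₂.IsConjSymmetric ∧ s.R₃.IsSymmetric ∧ s.R₄.IsSymmetric

/-- Type II: only `R₃` is conjugated. -/
def IsTypeII (s : SixJ N) : Prop :=
  s.R₁.IsSymmetric ∧ s.R₂.IsSymmetric ∧ s.R₃.IsConjSymmetric ∧ s.R₄.IsSymmetric

/-- Conjugation of all entries. -/
def conj (s : SixJ N) : SixJ N where
  R₁ := s.R₁.conj
  R₂ := s.R₂.conj
  X := s.X.conj
  R₃ := s.R₃.conj
  R₄ := s.R₄.conj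
  Y := s.Y.conj

/-- One basic tetrahedral symmetry (row and column permutations of the array). -/
inductive Tetra : SixJ N → SixJ N → Prop
  | rows13 (a b m c d n : Diagram N) :
      Tetra ⟨a, b, m, c, d, n⟩ ⟨c.conj, b.conj, n.conj, a.conj, d.conj, m.conj⟩
  | rows12 (a b m c d n : Diagram N) :
      Tetra ⟨a, b, m, c, d, n⟩ ⟨c, d.conj, m.conj, a, b.conj, n.conj⟩
  | cols23 (a b m c d n : Diagram N) :
      Tetra ⟨a, b, m, c, d, n⟩ ⟨a, m.conj, b.conj, c.conj, n.conj, d.conj⟩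
  | cols12 (a b m c d n : Diagram N) :
      Tetra ⟨a, b, m, c, d, n⟩ ⟨b, a, m, d.conj, c.conj, n.conj⟩

/-- Two arrays are related by (a composition of) tetrahedral symmetries and conjugation. -/
def Related : SixJ N → SixJ N → Prop :=
  Relation.EqvGen fun s t => Tetra s t ∨ t = s.conj

end SixJ

/-!
The proof needs only upper bounds for tensor products, and these follow from a Pieri rule in one
direction, proved here directly for `U_q(sl_N)` without complete reducibility or a PBW basis.

A nonzero intertwiner `C → A ⊗ B` between irreducible representations sends a highest weight vector
of weight `ν` to a nonzero highest weight vector `u` of `A ⊗ B`. If `π` is the coordinate of `A` at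
its highest weight vector, of weight `λ`, the contraction `b = (π ⊗ 1) u` is a vector of `B` of weight
`ν - λ`. It is nonzero, because `π` generates the dual of `A` under the right action of the `E i`
(`IsTopCoordinate.eq_top_of_mem`), and `E i ^ (λ i + 1) b = 0`, because `π E i ^ (λ i + 1) = 0`
(`IsTopCoordinate.E_pow_eq_zero`). The same works with the two factors exchanged; both versions are
instances of `exists_weightVector_of_contraction`.

If `B` is the symmetric representation `[r]`, its weight vectors are understood through the action on
homogeneous polynomials of degree `r` in `N` variables: the highest weight vectors of `B` and of the
polynomial model have the same annihilator (`apply_eq_zero_iff_modelAction`). Hence `ν - λ` is the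
weight of a monomial `x ^ m`, and `m (i + 1) ≤ λ i`; this is the statement that `ν` arises from `λ` by
adding a horizontal strip (`Occurs.isPieriStep_right`, `Occurs.isPieriStep_left`). The conjugate `[r]*`
is reduced to `[r]` by the automorphism of `U_q(sl_N)` coming from the symmetry of the Dynkin diagram.

For `X` in a 6-j symbol with symmetric or conjugate entries, the rule for `X` in `R₁ ⊗ R₂` puts `X`
into one of three one-parameter families: at most two rows and a given number of boxes, the dual of
such a diagram, or a component of `[a] ⊗ [b]*` with given `a - b`. The rule for `R₄` in `X ⊗ R₃` does
the same, and the families depend only on the signs (symmetric or conjugate) of the `R i`. Two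
different families meet in at most one diagram (`HasShape.eq_of_ne`), which makes the symbol trivial;
`Y` is treated in the same way. The families coincide exactly for those six of the sixteen patterns
of signs that are carried to type I or II by conjugation and the exchange of `R₁` and `R₃`.

For the second part, if some `R i` is empty the Pieri rule forces `X` and `Y` to be symmetric or
conjugate to symmetric. Otherwise every `R i` has a well defined sign, and `{X, Y}` is the only pair
of opposite entries of the tetrahedron that is not symmetric up to conjugation. The other four entries
`R₁, R₂, R₃, R₄*` form a cycle, on which the symmetries act through the dihedral group, so whether the
signs alternate along the cycle (type I) or not (type II) is an invariant
(`SixJ.Alternates`, `SixJ.Opposes`).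
-/

open UqGen Uq

/-! ### Representations generated by a highest weight vector -/

section HighestWeight

variable {N : ℕ} {q : ℂˣ} {V : Type*} [AddCommGroup V] [Module ℂ V]

theorem qpow_ne_zero (q : ℂˣ) (a : ℤ) : qpow q a ≠ 0 := Units.ne_zero _

/-- `q` is not a root of unity, so its integer powers are distinct. -/
theorem qpow_injective {q : ℂˣ} (hq : ∀ n : ℕ, 0 < n → (q : ℂ) ^ n ≠ 1) :
    Function.Injective (qpow q) := by
  have key : ∀ a b : ℤ, a < b → qpow q a ≠ qpow q b := by
    intro a b hab h
    obtain ⟨n, rfl⟩ : ∃ n : ℕ, b = a + n := ⟨(b - a).toNat, by omega⟩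
    apply hq n (by omega)
    rw [qpow_add] at h
    have := mul_left_cancel₀ (qpow_ne_zero q a) ((mul_one _).trans h)
    simpa [qpow] using this.symm
  intro a b h
  rcases lt_trichotomy a b with h' | h' | h'
  · exact absurd h (key _ _ h')
  · exact h'
  · exact absurd h.symm (key _ _ h')

/-- A subspace stable under the generators is a subrepresentation. -/
theorem Uq.mem_of_forall_gen (ρ : Uq N q →ₐ[ℂ] Module.End ℂ V) (W : Submodule ℂ V)
    (h : ∀ g, ∀ v ∈ W, ρ (gen q g) v ∈ W) (u : Uq N q) : ∀ v ∈ W, ρ u v ∈ W := by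
  obtain ⟨x, rfl⟩ := RingQuot.mkAlgHom_surjective ℂ (UqRel N q) u
  induction x using FreeAlgebra.induction with
  | grade0 r =>
    intro v hv
    rw [AlgHom.commutes, AlgHom.commutes]
    exact W.smul_mem r hv
  | grade1 g => exact h g
  | mul a b ha hb =>
    intro v hv
    rw [map_mul, map_mul]
    exact ha _ (hb v hv)
  | add a b ha hb =>
    intro v hv
    rw [map_add, map_add]
    exact W.add_mem (ha v hv) (hb v hv)

theorem Uq.rho_EF (ρ : Uq N q →ₐ[ℂ] Module.End ℂ V) (i j : Fin (N - 1)) (v : V) :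
    ρ (gen q (E i)) (ρ (gen q (F j)) v) = ρ (gen q (F j)) (ρ (gen q (E i)) v) +
      if i = j then (qpow q 1 - qpow q (-1))⁻¹ • (ρ (gen q (K i)) v - ρ (gen q (L i)) v)
        else 0 := by
  split_ifs with h
  · subst h
    have h1 := congrArg (fun u => ρ u v) (E_F_self (q := q) i)
    simp only [map_sub, map_mul, map_smul, LinearMap.sub_apply, Module.End.mul_apply,
      LinearMap.smul_apply] at h1
    rw [← h1]
    abel
  · have h1 := congrArg (fun u => ρ u v) (E_mul_F_of_ne (q := q) i j h)
    simpa using h1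

theorem Uq.rho_KF (ρ : Uq N q →ₐ[ℂ] Module.End ℂ V) (i j : Fin (N - 1)) (v : V) :
    ρ (gen q (K i)) (ρ (gen q (F j)) v) =
      qpow q (-cartanA i j) • ρ (gen q (F j)) (ρ (gen q (K i)) v) := by
  simpa using congrArg (fun u => ρ u v) (K_mul_F (q := q) i j)

theorem Uq.rho_KE (ρ : Uq N q →ₐ[ℂ] Module.End ℂ V) (i j : Fin (N - 1)) (v : V) :
    ρ (gen q (K i)) (ρ (gen q (E j)) v) =
      qpow q (cartanA i j) • ρ (gen q (E j)) (ρ (gen q (K i)) v) := by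
  simpa using congrArg (fun u => ρ u v) (K_mul_E (q := q) i j)

theorem Uq.rho_KL (ρ : Uq N q →ₐ[ℂ] Module.End ℂ V) (i : Fin (N - 1)) (v : V) :
    ρ (gen q (K i)) (ρ (gen q (L i)) v) = v := by
  simpa using congrArg (fun u => ρ u v) (K_mul_L (q := q) i)

theorem Uq.rho_LK (ρ : Uq N q →ₐ[ℂ] Module.End ℂ V) (i : Fin (N - 1)) (v : V) :
    ρ (gen q (L i)) (ρ (gen q (K i)) v) = v := by
  simpa using congrArg (fun u => ρ u v) (L_mul_K (q := q) i)

theorem Uq.rho_L_of_K (ρ : Uq N q →ₐ[ℂ] Module.End ℂ V) {i : Fin (N - 1)} {v : V} {a : ℤ}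
    (h : ρ (gen q (K i)) v = qpow q a • v) : ρ (gen q (L i)) v = qpow q (-a) • v := by
  have h1 := rho_LK ρ i v
  rw [h, map_smul] at h1
  nth_rewrite 2 [← h1]
  rw [smul_smul, mul_comm, qpow_mul_neg, one_smul]

/-- `v` is a highest weight vector (possibly zero) with Dynkin labels `d`. -/
def IsHighestWeight (ρ : Uq N q →ₐ[ℂ] Module.End ℂ V) (d : Fin (N - 1) → ℤ) (v : V) : Prop :=
  ∀ i, ρ (gen q (E i)) v = 0 ∧ ρ (gen q (K i)) v = qpow q (d i) • v

/-- The vector `F_{i₁} F_{i₂} ⋯ v` for the word `[i₁, i₂, …]` of simple roots. -/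
noncomputable def lowered (ρ : Uq N q →ₐ[ℂ] Module.End ℂ V) (v : V) : List (Fin (N - 1)) → V
  | [] => v
  | i :: l => ρ (gen q (F i)) (lowered ρ v l)

variable {ρ : Uq N q →ₐ[ℂ] Module.End ℂ V} {d : Fin (N - 1) → ℤ} {v : V}

theorem IsHighestWeight.K_lowered (h : IsHighestWeight ρ d v) (i : Fin (N - 1))
    (l : List (Fin (N - 1))) :
    ρ (gen q (K i)) (lowered ρ v l) =
      qpow q (d i - (l.map (cartanA i)).sum) • lowered ρ v l := by
  induction l with
  | nil => simpa [lowered] using (h i).2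
  | cons j l ih =>
    simp only [lowered, rho_KF, ih, map_smul, smul_smul, ← qpow_add]
    congr 2
    simp
    ring

/-- Words in the `F i` applied to a highest weight vector span a subrepresentation: the triangular
decomposition, in the only form needed here. -/
theorem IsHighestWeight.mem_span_lowered (h : IsHighestWeight ρ d v) (u : Uq N q) :
    ρ u v ∈ Submodule.span ℂ (Set.range (lowered ρ v)) := by
  set W := Submodule.span ℂ (Set.range (lowered ρ v)) with hW
  have hl : ∀ l, lowered ρ v l ∈ W := fun l => Submodule.subset_span ⟨l, rfl⟩
  have key : ∀ x : Uq N q, (∀ l, ρ x (lowered ρ v l) ∈ W) → ∀ w ∈ W, ρ x w ∈ W := by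
    intro x hx w hw
    have : W ≤ W.comap (ρ x) := by
      rw [hW, Submodule.span_le]
      rintro _ ⟨l, rfl⟩
      exact hx l
    exact this hw
  have hK : ∀ i, ∀ w ∈ W, ρ (gen q (K i)) w ∈ W := fun i => key _ fun l => by
    rw [h.K_lowered]
    exact W.smul_mem _ (hl l)
  have hL : ∀ i, ∀ w ∈ W, ρ (gen q (L i)) w ∈ W := fun i => key _ fun l => by
    rw [rho_L_of_K ρ (h.K_lowered i l)]
    exact W.smul_mem _ (hl l)
  have hF : ∀ i, ∀ w ∈ W, ρ (gen q (F i)) w ∈ W := fun i => key _ fun l => hl (i :: l)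
  refine mem_of_forall_gen ρ W ?_ u v (hl [])
  rintro (i | i | i | i)
  · refine key _ fun l => ?_
    induction l with
    | nil => simp [lowered, (h i).1]
    | cons j l ih =>
      rw [lowered, rho_EF]
      refine W.add_mem (hF _ _ ih) ?_
      split_ifs
      · exact W.smul_mem _ (W.sub_mem (hK _ _ (hl l)) (hL _ _ (hl l)))
      · exact W.zero_mem
  · exact hF i
  · exact hK i
  · exact hL i

/-! ### The height operator -/

/-- The coefficients `c i` with `∑ i, c i * cartanA i j = 2` (twice the half sum of the positive
coroots). -/
def heightCoeff {N : ℕ} (i : Fin (N - 1)) : ℤ := (i.val + 1) * (N - 1 - i.val)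

theorem sum_heightCoeff (j : Fin (N - 1)) : ∑ i, heightCoeff i * cartanA i j = 2 := by
  have hj := j.isLt
  have e : ∀ i : Fin (N - 1), heightCoeff i * cartanA i j =
      (if i = j then 2 * heightCoeff j else 0)
      - (if i.val + 1 = j.val then (j.val : ℤ) * (N - j.val) else 0)
      - (if i.val = j.val + 1 then ((j.val : ℤ) + 2) * (N - 2 - j.val) else 0) := by
    intro i
    have hi := i.isLt
    by_cases h1 : i = j
    · subst h1
      simp [cartanA_self]
      ring
    · by_cases h2 : i.val + 1 = j.val
      · have h3 : ¬ i.val = j.val + 1 := by omega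
        have h4 : (j.val : ℤ) = i.val + 1 := by omega
        rw [cartanA_adj (Or.inl h2), if_neg h1, if_pos h2, if_neg h3, heightCoeff, h4]
        ring
      · by_cases h3 : i.val = j.val + 1
        · have h4 : (i.val : ℤ) = j.val + 1 := by omega
          rw [cartanA_adj (Or.inr h3.symm), if_neg h1, if_neg h2, if_pos h3, heightCoeff, h4]
          ring
        · rw [cartanA_far h1 (by unfold AdjRoots; omega), if_neg h1, if_neg h2, if_neg h3]
          ring
  have s2 : ∑ i : Fin (N - 1), (if i.val + 1 = j.val then (j.val : ℤ) * (N - j.val) else 0)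
      = (j.val : ℤ) * (N - j.val) := by
    by_cases h0 : j.val = 0
    · simp [h0]
    · rw [Finset.sum_eq_single (⟨j.val - 1, by omega⟩ : Fin (N - 1))]
      · rw [if_pos (by simp only; omega)]
      · intro b _ hb
        rw [if_neg]
        intro h
        apply hb
        apply Fin.ext
        simp only
        omega
      · simp
  have s3 : ∑ i : Fin (N - 1),
      (if i.val = j.val + 1 then ((j.val : ℤ) + 2) * (N - 2 - j.val) else 0)
      = ((j.val : ℤ) + 2) * (N - 2 - j.val) := by
    by_cases h0 : j.val + 1 < N - 1
    · rw [Finset.sum_eq_single (⟨j.val + 1, h0⟩ : Fin (N - 1))]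
      · rw [if_pos rfl]
      · intro b _ hb
        rw [if_neg]
        intro h
        exact hb (Fin.ext h)
      · simp
    · have : (N : ℤ) - 2 - j.val = 0 := by omega
      simp [this]
  rw [Finset.sum_congr rfl fun i _ => e i, Finset.sum_sub_distrib, Finset.sum_sub_distrib, s2, s3,
    Finset.sum_ite_eq' Finset.univ j, if_pos (Finset.mem_univ j), heightCoeff]
  ring

theorem heightCoeff_nonneg (i : Fin (N - 1)) : 0 ≤ heightCoeff i := by
  have := i.isLt
  exact mul_nonneg (by omega) (by omega)

/-- The product of the `(K i) ^ (c i)`, with `c i = heightCoeff i`. Its eigenvalue on a weight vector is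
multiplied by `q ^ (-2)` when any one simple root is subtracted from the weight. -/
noncomputable def heightOp (ρ : Uq N q →ₐ[ℂ] Module.End ℂ V) : Module.End ℂ V :=
  ((List.finRange (N - 1)).map fun i => ρ (gen q (K i)) ^ (heightCoeff i).toNat).prod

theorem heightOp_apply (ρ : Uq N q →ₐ[ℂ] Module.End ℂ V) (e : Fin (N - 1) → ℤ) (x : V)
    (hx : ∀ i, ρ (gen q (K i)) x = qpow q (e i) • x) :
    heightOp ρ x = qpow q (∑ i, heightCoeff i * e i) • x := by
  have hp : ∀ i (n : ℕ), (ρ (gen q (K i)) ^ n) x = qpow q (n * e i) • x := by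
    intro i n
    induction n with
    | zero => simp [qpow_zero]
    | succ n ih =>
      rw [pow_succ', Module.End.mul_apply, ih, map_smul, hx, smul_smul, ← qpow_add]
      congr 2
      push_cast
      ring
  have hl : ∀ l : List (Fin (N - 1)),
      (l.map fun i => ρ (gen q (K i)) ^ (heightCoeff i).toNat).prod x =
        qpow q (l.map fun i => heightCoeff i * e i).sum • x := by
    intro l
    induction l with
    | nil => simp [qpow_zero]
    | cons i l ih =>
      rw [List.map_cons, List.prod_cons, Module.End.mul_apply, ih, map_smul, hp, smul_smul,
        List.map_cons, List.sum_cons, ← qpow_add, Int.toNat_of_nonneg (heightCoeff_nonneg i),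
        add_comm]
  rw [heightOp, hl, ← List.ofFn_eq_map, List.sum_ofFn]

theorem IsHighestWeight.heightOp_lowered (h : IsHighestWeight ρ d v) (l : List (Fin (N - 1))) :
    heightOp ρ (lowered ρ v l) =
      qpow q (∑ i, heightCoeff i * d i - 2 * l.length) • lowered ρ v l := by
  rw [heightOp_apply ρ _ _ fun i => h.K_lowered i l]
  congr 2
  simp only [mul_sub, Finset.sum_sub_distrib]
  congr 1
  induction l with
  | nil => simp
  | cons j l ih =>
    simp only [List.map_cons, List.sum_cons, mul_add, Finset.sum_add_distrib, ih,
      sum_heightCoeff, List.length_cons]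
    push_cast
    ring

/-- A nonzero highest weight vector is not a combination of vectors of lower weight: the latter lie in
other eigenspaces of the height operator, as `q` is not a root of unity. -/
theorem IsHighestWeight.notMem_span_lowered (hq : ∀ n : ℕ, 0 < n → (q : ℂ) ^ n ≠ 1)
    (h : IsHighestWeight ρ d v) (hv : v ≠ 0) :
    v ∉ Submodule.span ℂ {x | ∃ l ≠ [], x = lowered ρ v l} := by
  intro hmem
  set t := qpow q (∑ i, heightCoeff i * d i) with ht
  have h1 : v ∈ (heightOp ρ).eigenspace t := by
    rw [Module.End.mem_eigenspace_iff]
    simpa [lowered] using h.heightOp_lowered []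
  have h2 : v ∈ ⨆ μ ≠ t, (heightOp ρ).eigenspace μ := by
    refine Submodule.span_le.mpr ?_ hmem
    rintro _ ⟨l, hl, rfl⟩
    refine Submodule.mem_iSup_of_mem (qpow q (∑ i, heightCoeff i * d i - 2 * l.length))
      (Submodule.mem_iSup_of_mem ?_ ?_)
    · intro he
      have := qpow_injective hq he
      have := List.length_pos_of_ne_nil hl
      omega
    · exact Module.End.mem_eigenspace_iff.mpr (h.heightOp_lowered l)
  exact hv ((Submodule.disjoint_def.mp ((heightOp ρ).eigenspaces_iSupIndep t)) v h1 h2)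

end HighestWeight

/-! ### The coordinate functional of the highest weight vector -/

section Coordinate

variable {N : ℕ} {q : ℂˣ} {V : Type*} [AddCommGroup V] [Module ℂ V]

/-- Irreducibility of an action of `U_q(sl_N)`; the zero space is not excluded. -/
def IsIrreducibleAction (ρ : Uq N q →ₐ[ℂ] Module.End ℂ V) : Prop :=
  ∀ W : Submodule ℂ V, (∀ (u : Uq N q), ∀ v ∈ W, ρ u v ∈ W) → W = ⊥ ∨ W = ⊤

variable {ρ : Uq N q →ₐ[ℂ] Module.End ℂ V} {d : Fin (N - 1) → ℤ} {v : V}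

theorem IsIrreducibleAction.exists_apply_eq (hρ : IsIrreducibleAction ρ) (hv : v ≠ 0) (x : V) :
    ∃ u, ρ u v = x := by
  let W : Submodule ℂ V := LinearMap.range (LinearMap.applyₗ v ∘ₗ ρ.toLinearMap)
  have hW : ∀ x, x ∈ W ↔ ∃ u, ρ u v = x := fun x => LinearMap.mem_range
  have h := hρ W fun u w hw => by
    obtain ⟨u', rfl⟩ := (hW w).mp hw
    exact (hW _).mpr ⟨u * u', by simp⟩
  have hvW : v ∈ W := (hW v).mpr ⟨1, by simp⟩
  rcases h with h | h
  · rw [h] at hvW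
    exact absurd ((Submodule.mem_bot ℂ).mp hvW) hv
  · exact (hW x).mp (h ▸ Submodule.mem_top)

theorem IsHighestWeight.span_lowered_eq_top (h : IsHighestWeight ρ d v)
    (hρ : IsIrreducibleAction ρ) (hv : v ≠ 0) :
    Submodule.span ℂ (Set.range (lowered ρ v)) = ⊤ := by
  rw [eq_top_iff]
  intro x _
  obtain ⟨u, rfl⟩ := hρ.exists_apply_eq hv x
  exact h.mem_span_lowered u

/-- `π` behaves as the coordinate at a highest weight vector with Dynkin labels `d`: it is a highest
weight vector of the dual, for the right action. -/
structure IsTopCoordinate (ρ : Uq N q →ₐ[ℂ] Module.End ℂ V) (d : Fin (N - 1) → ℤ)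
    (π : Module.Dual ℂ V) : Prop where
  apply_F : ∀ i x, π (ρ (gen q (F i)) x) = 0
  apply_K : ∀ i x, π (ρ (gen q (K i)) x) = qpow q (d i) * π x

/-- The coordinate at the highest weight vector, with respect to the span of the lower weights. -/
theorem IsHighestWeight.exists_coordinate (hq : ∀ n : ℕ, 0 < n → (q : ℂ) ^ n ≠ 1)
    (h : IsHighestWeight ρ d v) (hρ : IsIrreducibleAction ρ) (hv : v ≠ 0) :
    ∃ π : Module.Dual ℂ V, π v = 1 ∧ IsTopCoordinate ρ d π := by
  obtain ⟨f, hf, hf'⟩ := Submodule.exists_le_ker_of_notMem (h.notMem_span_lowered hq hv)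
  have hlow : ∀ l ≠ [], f (lowered ρ v l) = 0 := fun l hl =>
    hf' (Submodule.subset_span ⟨l, hl, rfl⟩)
  have ext : ∀ g g' : Module.Dual ℂ V, (∀ l, g (lowered ρ v l) = g' (lowered ρ v l)) → g = g' :=
    fun g g' hg => LinearMap.ext_on (h.span_lowered_eq_top hρ hv) (by
      rintro _ ⟨l, rfl⟩
      exact hg l)
  refine ⟨(f v)⁻¹ • f, by simp [hf], ⟨fun i x => ?_, fun i x => ?_⟩⟩
  · have : f ∘ₗ ρ (gen q (F i)) = 0 := ext _ _ fun l => by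
      simpa [lowered] using hlow (i :: l) (by simp)
    have := LinearMap.congr_fun this x
    simp at this
    simp [this]
  · have : f ∘ₗ ρ (gen q (K i)) = qpow q (d i) • f := ext _ _ fun l => by
      rw [LinearMap.comp_apply, h.K_lowered, map_smul, LinearMap.smul_apply]
      by_cases hl : l = []
      · simp [hl]
      · simp [hlow l hl]
    have := LinearMap.congr_fun this x
    simp at this
    simp [this]
    ring

variable {π : Module.Dual ℂ V}

/-- The functionals obtained from `π` by the right action of words in the `E i`. -/
inductive Raised (ρ : Uq N q →ₐ[ℂ] Module.End ℂ V) (π : Module.Dual ℂ V) : Module.Dual ℂ V → Prop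
  | base : Raised ρ π π
  | step (φ : Module.Dual ℂ V) (i : Fin (N - 1)) :
      Raised ρ π φ → Raised ρ π (φ ∘ₗ ρ (gen q (E i)))

theorem IsTopCoordinate.raised_K (h : IsTopCoordinate ρ d π) {φ : Module.Dual ℂ V}
    (hφ : Raised ρ π φ) (i : Fin (N - 1)) : ∃ c : ℂ, ∀ x, φ (ρ (gen q (K i)) x) = c * φ x := by
  induction hφ with
  | base => exact ⟨_, h.apply_K i⟩
  | step φ j _ ih =>
    obtain ⟨c, hc⟩ := ih
    refine ⟨qpow q (-cartanA i j) * c, fun x => ?_⟩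
    have h1 := hc (ρ (gen q (E j)) x)
    rw [rho_KE, map_smul, smul_eq_mul] at h1
    simp only [LinearMap.comp_apply]
    rw [mul_assoc, ← h1, ← mul_assoc, mul_comm (qpow q (-cartanA i j)), qpow_mul_neg, one_mul]

theorem IsTopCoordinate.raised_L (h : IsTopCoordinate ρ d π) {φ : Module.Dual ℂ V}
    (hφ : Raised ρ π φ) (i : Fin (N - 1)) : ∃ c : ℂ, ∀ x, φ (ρ (gen q (L i)) x) = c * φ x := by
  obtain ⟨c, hc⟩ := h.raised_K hφ i
  refine ⟨c⁻¹, fun x => ?_⟩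
  have h1 := hc (ρ (gen q (L i)) x)
  rw [rho_KL] at h1
  by_cases h0 : c = 0
  · have hz : ∀ y, φ y = 0 := fun y => by
      rw [← rho_KL ρ i y, hc, h0, zero_mul]
    simp [hz]
  · rw [h1, inv_mul_cancel_left₀ h0]

/-- In an irreducible representation, the top coordinate generates the dual under the `E i`. -/
theorem IsTopCoordinate.eq_top_of_mem [FiniteDimensional ℂ V] (h : IsTopCoordinate ρ d π)
    (hρ : IsIrreducibleAction ρ) (hπ : π ≠ 0) (S : Submodule ℂ (Module.Dual ℂ V)) (hS : π ∈ S)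
    (hE : ∀ φ ∈ S, ∀ i, φ ∘ₗ ρ (gen q (E i)) ∈ S) : S = ⊤ := by
  have hR : ∀ φ, Raised ρ π φ → φ ∈ S := fun φ hφ => by
    induction hφ with
    | base => exact hS
    | step φ i _ ih => exact hE φ ih i
  -- the common kernel of the raised functionals is a subrepresentation
  let Z : Submodule ℂ V := (Submodule.span ℂ {φ | Raised ρ π φ}).dualCoannihilator
  have hZ : ∀ x, x ∈ Z ↔ ∀ φ, Raised ρ π φ → φ x = 0 := fun x => by
    refine Submodule.mem_dualCoannihilator x |>.trans ⟨fun H φ hφ => H φ (Submodule.subset_span hφ),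
      fun H φ hφ => ?_⟩
    induction hφ using Submodule.span_induction with
    | mem φ hφ => exact H φ hφ
    | zero => rfl
    | add φ ψ _ _ h1 h2 => simp [h1, h2]
    | smul c φ _ h1 => simp [h1]
  have hZE : ∀ i, ∀ x ∈ Z, ρ (gen q (E i)) x ∈ Z := fun i x hx =>
    (hZ _).mpr fun φ hφ => (hZ x).mp hx _ (Raised.step φ i hφ)
  have hZF : ∀ φ, Raised ρ π φ → ∀ i, ∀ x ∈ Z, φ (ρ (gen q (F i)) x) = 0 := fun φ hφ => by
    induction hφ with
    | base => exact fun i x _ => h.apply_F i x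
    | step φ j hφ ih =>
      intro i x hx
      rw [LinearMap.comp_apply, rho_EF, map_add, ih i _ (hZE j x hx), zero_add]
      obtain ⟨c, hc⟩ := h.raised_K hφ j
      obtain ⟨c', hc'⟩ := h.raised_L hφ j
      split_ifs
      · rw [map_smul, map_sub, hc, hc', (hZ x).mp hx φ hφ]
        simp
      · simp
  have hinv := hρ Z (mem_of_forall_gen ρ Z (by
    rintro (i | i | i | i) x hx
    · exact hZE i x hx
    · exact (hZ _).mpr fun φ hφ => hZF φ hφ i x hx
    · refine (hZ _).mpr fun φ hφ => ?_
      obtain ⟨c, hc⟩ := h.raised_K hφ i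
      rw [hc, (hZ x).mp hx φ hφ, mul_zero]
    · refine (hZ _).mpr fun φ hφ => ?_
      obtain ⟨c, hc⟩ := h.raised_L hφ i
      rw [hc, (hZ x).mp hx φ hφ, mul_zero]))
  have hbot : Z = ⊥ := by
    refine hinv.resolve_right fun ht => hπ (LinearMap.ext fun x => ?_)
    exact (hZ x).mp (ht ▸ Submodule.mem_top) π Raised.base
  -- in finite dimension a space of functionals without common zeros is the whole dual
  have htop : Submodule.span ℂ {φ | Raised ρ π φ} = ⊤ := by
    rw [← Subspace.dualCoannihilator_dualAnnihilator_eq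
      (W := Submodule.span ℂ {φ | Raised ρ π φ})]
    change Z.dualAnnihilator = ⊤
    rw [hbot, Submodule.dualAnnihilator_bot]
  rw [eq_top_iff, ← htop, Submodule.span_le]
  exact hR

/-- The quantum integer `[a] = (q ^ a - q ^ (-a)) / (q - q⁻¹)`. -/
noncomputable def qint (q : ℂˣ) (a : ℤ) : ℂ :=
  (qpow q 1 - qpow q (-1))⁻¹ * (qpow q a - qpow q (-a))

theorem qint_neg (q : ℂˣ) (a : ℤ) : qint q (-a) = -qint q a := by
  simp only [qint, neg_neg]
  ring

theorem qint_zero (q : ℂˣ) : qint q 0 = 0 := by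
  simp [qint]

theorem qint_ne_zero (hq : ∀ n : ℕ, 0 < n → (q : ℂ) ^ n ≠ 1) {a : ℤ} (ha : a ≠ 0) :
    qint q a ≠ 0 := by
  have key : ∀ b : ℤ, b ≠ 0 → qpow q b - qpow q (-b) ≠ 0 := fun b hb h => by
    have := qpow_injective hq (sub_eq_zero.mp h)
    omega
  exact mul_ne_zero (inv_ne_zero (key 1 one_ne_zero)) (key a ha)

theorem IsTopCoordinate.E_pow_K (h : IsTopCoordinate ρ d π) (i : Fin (N - 1)) (n : ℕ) (x : V) :
    π ((ρ (gen q (E i)) ^ n) (ρ (gen q (K i)) x)) =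
      qpow q (d i - 2 * n) * π ((ρ (gen q (E i)) ^ n) x) := by
  induction n generalizing x with
  | zero => simpa using h.apply_K i x
  | succ n ih =>
    have h1 := ih (ρ (gen q (E i)) x)
    rw [rho_KE, map_smul, map_smul, cartanA_self, smul_eq_mul] at h1
    rw [pow_succ, Module.End.mul_apply, Module.End.mul_apply]
    calc _ = qpow q (-2) * (qpow q 2 *
          π ((ρ (gen q (E i)) ^ n) (ρ (gen q (E i)) (ρ (gen q (K i)) x)))) := by
          rw [← mul_assoc, ← qpow_add, neg_add_cancel, qpow_zero, one_mul]
      _ = _ := by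
          rw [h1, ← mul_assoc, ← qpow_add]
          congr 2
          push_cast
          ring

theorem IsTopCoordinate.E_pow_L (h : IsTopCoordinate ρ d π) (i : Fin (N - 1)) (n : ℕ) (x : V) :
    π ((ρ (gen q (E i)) ^ n) (ρ (gen q (L i)) x)) =
      qpow q (-(d i - 2 * n)) * π ((ρ (gen q (E i)) ^ n) x) := by
  have := h.E_pow_K i n (ρ (gen q (L i)) x)
  rw [rho_KL] at this
  rw [this, ← mul_assoc, ← qpow_add, neg_add_cancel, qpow_zero, one_mul]

/-- The dual form of the commutation of `F i` past a power of `E i`: only `[E i, F i]` contributes, as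
`π` kills the image of every `F j`. -/
theorem IsTopCoordinate.E_pow_succ_F (h : IsTopCoordinate ρ d π) (i j : Fin (N - 1)) (n : ℕ)
    (x : V) :
    π ((ρ (gen q (E i)) ^ (n + 1)) (ρ (gen q (F j)) x)) =
      (if i = j then ∑ k ∈ Finset.range (n + 1), qint q (d i - 2 * k) else 0) *
        π ((ρ (gen q (E i)) ^ n) x) := by
  have step : ∀ (n : ℕ) (x : V), π ((ρ (gen q (E i)) ^ (n + 1)) (ρ (gen q (F j)) x)) =
      π ((ρ (gen q (E i)) ^ n) (ρ (gen q (F j)) (ρ (gen q (E i)) x))) +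
        (if i = j then qint q (d i - 2 * n) else 0) * π ((ρ (gen q (E i)) ^ n) x) := by
    intro n x
    rw [pow_succ, Module.End.mul_apply, rho_EF, map_add, map_add]
    congr 1
    split_ifs
    · rw [map_smul, map_smul, map_sub, map_sub, h.E_pow_K, h.E_pow_L, qint, smul_eq_mul]
      ring
    · simp
  induction n generalizing x with
  | zero =>
    rw [step, pow_zero, Module.End.one_apply, h.apply_F, zero_add, Module.End.one_apply]
    simp
  | succ n ih =>
    rw [step, ih, ← Module.End.mul_apply, ← pow_succ]
    split_ifs
    · rw [Finset.sum_range_succ _ (n + 1)]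
      ring
    · ring

/-- The summands with indices `k` and `n - k` cancel. -/
theorem sum_qint_eq_zero (q : ℂˣ) (n : ℕ) :
    ∑ k ∈ Finset.range (n + 1), qint q (n - 2 * k) = 0 := by
  have h := Finset.sum_range_reflect (fun k : ℕ => qint q (n - 2 * k)) (n + 1)
  have h2 : ∑ k ∈ Finset.range (n + 1), qint q ((n : ℤ) - 2 * ((n + 1 - 1 - k : ℕ) : ℤ)) =
      ∑ k ∈ Finset.range (n + 1), -qint q (n - 2 * k) := by
    refine Finset.sum_congr rfl fun k hk => ?_
    rw [← qint_neg]
    congr 1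
    have := Finset.mem_range.mp hk
    omega
  rw [h2, Finset.sum_neg_distrib] at h
  exact CharZero.neg_eq_self_iff.mp h

/-- The dual form of `F i ^ (d i + 1) v = 0`. -/
theorem IsTopCoordinate.E_pow_eq_zero (h : IsTopCoordinate ρ d π) (hv : IsHighestWeight ρ d v)
    (hspan : Submodule.span ℂ (Set.range (lowered ρ v)) = ⊤) (i : Fin (N - 1)) (n : ℕ)
    (hn : d i = n) (x : V) : π ((ρ (gen q (E i)) ^ (n + 1)) x) = 0 := by
  have : π ∘ₗ (ρ (gen q (E i)) ^ (n + 1)) = 0 := by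
    refine LinearMap.ext_on hspan ?_
    rintro _ ⟨l, rfl⟩
    cases l with
    | nil => simp [lowered, pow_succ, (hv i).1]
    | cons j l =>
      rw [LinearMap.comp_apply, lowered, h.E_pow_succ_F, hn, sum_qint_eq_zero]
      simp
  exact LinearMap.congr_fun this x

end Coordinate

/-! ### Contraction of a highest weight vector in a tensor product -/

section Contraction

variable {N : ℕ} {q : ℂˣ} {V W : Type} [AddCommGroup V] [Module ℂ V] [AddCommGroup W] [Module ℂ W]

/-- If `γ` is the contraction of a highest weight vector of `V ⊗ W` or `W ⊗ V` with functionals on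
the irreducible representation `V`, then its value at the top coordinate of `V` is a nonzero weight
vector of `W` killed by the powers of the `E i` that the Dynkin labels of `V` prescribe. -/
theorem exists_weightVector_of_contraction [FiniteDimensional ℂ V]
    (hq : ∀ n : ℕ, 0 < n → (q : ℂ) ^ n ≠ 1)
    {ρ : Uq N q →ₐ[ℂ] Module.End ℂ V} {σ : Uq N q →ₐ[ℂ] Module.End ℂ W}
    {d : Fin (N - 1) → ℕ} {a : V} (ha : IsHighestWeight ρ (fun i => d i) a) (ha0 : a ≠ 0)
    (hρ : IsIrreducibleAction ρ) (e : Fin (N - 1) → ℤ)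
    (γ : Module.Dual ℂ V →ₗ[ℂ] W) (hγ : γ ≠ 0) (c : Fin (N - 1) → ℂ) (hc : ∀ i, c i ≠ 0)
    (hE : ∀ i φ, σ (gen q (E i)) (γ φ) =
      c i • γ (φ ∘ₗ ρ (gen q (L i)) ∘ₗ ρ (gen q (E i))))
    (hK : ∀ i φ, σ (gen q (K i)) (γ (φ ∘ₗ ρ (gen q (K i)))) = qpow q (e i) • γ φ) :
    ∃ b : W, b ≠ 0 ∧ ∀ i, σ (gen q (K i)) b = qpow q (e i - d i) • b ∧
      (σ (gen q (E i)) ^ (d i + 1)) b = 0 := by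
  obtain ⟨π, hπ1, hπ⟩ := ha.exists_coordinate hq hρ ha0
  have hπ0 : π ≠ 0 := by
    rintro rfl
    simp at hπ1
  have hKL : ∀ i (φ : Module.Dual ℂ V), (φ ∘ₗ ρ (gen q (K i))) ∘ₗ ρ (gen q (L i)) = φ :=
    fun i φ => LinearMap.ext fun x => by simp [rho_KL]
  refine ⟨γ π, fun h0 => hγ ?_, fun i => ⟨?_, ?_⟩⟩
  -- the kernel of `γ` is stable under the `E i`, so it does not contain the generator `π`
  · have htop := hπ.eq_top_of_mem hρ hπ0 (LinearMap.ker γ) h0 fun φ hφ i => by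
      have hφK : γ (φ ∘ₗ ρ (gen q (K i))) = 0 := by
        rw [← rho_LK σ i (γ (φ ∘ₗ ρ (gen q (K i)))), hK, LinearMap.mem_ker.mp hφ]
        simp
      have h1 := hE i (φ ∘ₗ ρ (gen q (K i)))
      rw [hφK, map_zero, ← LinearMap.comp_assoc, hKL] at h1
      exact LinearMap.mem_ker.mpr ((smul_eq_zero.mp h1.symm).resolve_left (hc i))
    exact LinearMap.ker_eq_top.mp htop
  · have h1 : π ∘ₗ ρ (gen q (K i)) = qpow q (d i) • π := LinearMap.ext fun x => by
      simp [hπ.apply_K]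
    have h2 := hK i π
    rw [h1, map_smul, map_smul] at h2
    rw [show e i - (d i : ℤ) = -(d i) + e i by ring, qpow_add, ← smul_smul, ← h2, smul_smul,
      mul_comm, qpow_mul_neg, one_smul]
  · have h1 : ∀ n : ℕ, ∃ s : ℂ,
        (σ (gen q (E i)) ^ n) (γ π) = s • γ (π ∘ₗ (ρ (gen q (E i)) ^ n)) := by
      intro n
      induction n with
      | zero => exact ⟨1, by rw [one_smul]; rfl⟩
      | succ n ih =>
        obtain ⟨s, hs⟩ := ih
        refine ⟨s * c i * qpow q (-(d i - 2 * n)), ?_⟩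
        rw [pow_succ', Module.End.mul_apply, hs, map_smul, hE, mul_smul, mul_smul]
        have h3 : (π ∘ₗ ρ (gen q (E i)) ^ n) ∘ₗ ρ (gen q (L i)) ∘ₗ ρ (gen q (E i)) =
            qpow q (-(d i - 2 * n)) • (π ∘ₗ ρ (gen q (E i)) ^ (n + 1)) :=
          LinearMap.ext fun x => by simp [hπ.E_pow_L, pow_succ]
        rw [h3, γ.map_smul]
    obtain ⟨s, hs⟩ := h1 (d i + 1)
    have h2 : π ∘ₗ (ρ (gen q (E i)) ^ (d i + 1)) = 0 := LinearMap.ext fun x =>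
      hπ.E_pow_eq_zero ha (ha.span_lowered_eq_top hρ ha0) i (d i) rfl x
    rw [hs, h2, LinearMap.map_zero, smul_zero]

/-- Contraction of `u : V ⊗ W` with functionals on the left factor. -/
noncomputable def contractFst (u : V ⊗[ℂ] W) : Module.Dual ℂ V →ₗ[ℂ] W where
  toFun φ := TensorProduct.lid ℂ W (TensorProduct.map φ LinearMap.id u)
  map_add' φ ψ := by rw [TensorProduct.map_add_left, LinearMap.add_apply, map_add]
  map_smul' c φ := by
    rw [TensorProduct.map_smul_left, LinearMap.smul_apply, map_smul, RingHom.id_apply]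

/-- Contraction of `u : W ⊗ V` with functionals on the right factor. -/
noncomputable def contractSnd (u : W ⊗[ℂ] V) : Module.Dual ℂ V →ₗ[ℂ] W where
  toFun φ := TensorProduct.rid ℂ W (TensorProduct.map LinearMap.id φ u)
  map_add' φ ψ := by rw [TensorProduct.map_add_right, LinearMap.add_apply, map_add]
  map_smul' c φ := by
    rw [TensorProduct.map_smul_right, LinearMap.smul_apply, map_smul, RingHom.id_apply]

theorem contractFst_tmul (x : V) (y : W) (φ : Module.Dual ℂ V) :
    contractFst (x ⊗ₜ[ℂ] y) φ = φ x • y := by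
  simp [contractFst]

theorem contractSnd_tmul (x : W) (y : V) (φ : Module.Dual ℂ V) :
    contractSnd (x ⊗ₜ[ℂ] y) φ = φ y • x := by
  simp [contractSnd]

theorem contractFst_add (u u' : V ⊗[ℂ] W) : contractFst (u + u') = contractFst u + contractFst u' :=
  LinearMap.ext fun φ => by simp [contractFst]

theorem contractSnd_add (u u' : W ⊗[ℂ] V) : contractSnd (u + u') = contractSnd u + contractSnd u' :=
  LinearMap.ext fun φ => by simp [contractSnd]

theorem contractFst_zero : contractFst (0 : V ⊗[ℂ] W) = 0 :=
  LinearMap.ext fun φ => by simp [contractFst]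

theorem contractSnd_zero : contractSnd (0 : W ⊗[ℂ] V) = 0 :=
  LinearMap.ext fun φ => by simp [contractSnd]

theorem contractFst_smul (c : ℂ) (u : V ⊗[ℂ] W) : contractFst (c • u) = c • contractFst u :=
  LinearMap.ext fun φ => by simp [contractFst]

theorem contractSnd_smul (c : ℂ) (u : W ⊗[ℂ] V) : contractSnd (c • u) = c • contractSnd u :=
  LinearMap.ext fun φ => by simp [contractSnd]

theorem contractFst_map (f : Module.End ℂ V) (g : Module.End ℂ W) (u : V ⊗[ℂ] W)
    (φ : Module.Dual ℂ V) :
    contractFst (TensorProduct.map f g u) φ = g (contractFst u (φ ∘ₗ f)) := by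
  induction u using TensorProduct.induction_on with
  | zero => simp [contractFst_zero]
  | tmul x y => simp [contractFst_tmul]
  | add x y hx hy => simp [contractFst_add, hx, hy]

theorem contractSnd_map (f : Module.End ℂ W) (g : Module.End ℂ V) (u : W ⊗[ℂ] V)
    (φ : Module.Dual ℂ V) :
    contractSnd (TensorProduct.map f g u) φ = f (contractSnd u (φ ∘ₗ g)) := by
  induction u using TensorProduct.induction_on with
  | zero => simp [contractSnd_zero]
  | tmul x y => simp [contractSnd_tmul]
  | add x y hx hy => simp [contractSnd_add, hx, hy]

theorem contractFst_ne_zero [FiniteDimensional ℂ V] {u : V ⊗[ℂ] W} (hu : u ≠ 0) :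
    contractFst u ≠ 0 := by
  let b := Module.finBasis ℂ V
  have key : ∀ u : V ⊗[ℂ] W, u = ∑ i, b i ⊗ₜ contractFst u (b.coord i) := by
    intro u
    induction u using TensorProduct.induction_on with
    | zero => simp [contractFst_zero]
    | tmul x y =>
      simp only [contractFst_tmul, ← TensorProduct.smul_tmul,
        ← TensorProduct.sum_tmul, Module.Basis.coord_apply, b.sum_repr]
    | add x y hx hy =>
      simp only [contractFst_add, LinearMap.add_apply, TensorProduct.tmul_add,
        Finset.sum_add_distrib, ← hx, ← hy]
  intro h
  apply hu
  rw [key u, h]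
  simp

theorem contractSnd_ne_zero [FiniteDimensional ℂ V] {u : W ⊗[ℂ] V} (hu : u ≠ 0) :
    contractSnd u ≠ 0 := by
  let b := Module.finBasis ℂ V
  have key : ∀ u : W ⊗[ℂ] V, u = ∑ i, contractSnd u (b.coord i) ⊗ₜ b i := by
    intro u
    induction u using TensorProduct.induction_on with
    | zero => simp [contractSnd_zero]
    | tmul x y =>
      simp only [contractSnd_tmul, TensorProduct.smul_tmul,
        ← TensorProduct.tmul_sum, Module.Basis.coord_apply, b.sum_repr]
    | add x y hx hy =>
      simp only [contractSnd_add, LinearMap.add_apply, TensorProduct.add_tmul,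
        Finset.sum_add_distrib, ← hx, ← hy]
  intro h
  apply hu
  rw [key u, h]
  simp

theorem tensorAction_E (ρ : Uq N q →ₐ[ℂ] Module.End ℂ V) (σ : Uq N q →ₐ[ℂ] Module.End ℂ W)
    (i : Fin (N - 1)) (u : V ⊗[ℂ] W) : UqRep.tensorAction ρ σ (gen q (E i)) u =
      TensorProduct.map (ρ (gen q (E i))) (σ (gen q (K i))) u +
        TensorProduct.map LinearMap.id (σ (gen q (E i))) u := by
  simp [UqRep.tensorAction, comul_gen, comulGen, Module.endTensorEndAlgHom_apply]
  rfl

theorem tensorAction_K (ρ : Uq N q →ₐ[ℂ] Module.End ℂ V) (σ : Uq N q →ₐ[ℂ] Module.End ℂ W)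
    (i : Fin (N - 1)) (u : V ⊗[ℂ] W) : UqRep.tensorAction ρ σ (gen q (K i)) u =
      TensorProduct.map (ρ (gen q (K i))) (σ (gen q (K i))) u := by
  simp [UqRep.tensorAction, comul_gen, comulGen, Module.endTensorEndAlgHom_apply]
  rfl

variable {ρ : Uq N q →ₐ[ℂ] Module.End ℂ V} {σ : Uq N q →ₐ[ℂ] Module.End ℂ W}
  {d : Fin (N - 1) → ℕ} {a : V}

/-- Contraction of a highest weight vector with the top coordinate of the left factor. -/
theorem exists_weightVector_right [FiniteDimensional ℂ V] (hq : ∀ n : ℕ, 0 < n → (q : ℂ) ^ n ≠ 1)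
    (ha : IsHighestWeight ρ (fun i => d i) a) (ha0 : a ≠ 0) (hρ : IsIrreducibleAction ρ)
    (e : Fin (N - 1) → ℤ) (u : V ⊗[ℂ] W) (hu0 : u ≠ 0)
    (hu : IsHighestWeight (UqRep.tensorAction ρ σ) e u) :
    ∃ b : W, b ≠ 0 ∧ ∀ i, σ (gen q (K i)) b = qpow q (e i - d i) • b ∧
      (σ (gen q (E i)) ^ (d i + 1)) b = 0 := by
  have hK : ∀ i φ, σ (gen q (K i)) (contractFst u (φ ∘ₗ ρ (gen q (K i)))) =
      qpow q (e i) • contractFst u φ := fun i φ => by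
    rw [← contractFst_map, ← tensorAction_K, (hu i).2, contractFst_smul, LinearMap.smul_apply]
  refine exists_weightVector_of_contraction hq ha ha0 hρ e (contractFst u)
    (contractFst_ne_zero hu0) (fun i => -qpow q (2 + e i)) (fun i => neg_ne_zero.mpr
      (qpow_ne_zero _ _)) (fun i φ => ?_) hK
  have h1 := congrArg (fun w => contractFst w φ) (tensorAction_E ρ σ i u)
  simp only [(hu i).1, contractFst_add, LinearMap.add_apply, contractFst_map, LinearMap.comp_id,
    contractFst_zero, LinearMap.zero_apply] at h1
  have h2 : φ ∘ₗ ρ (gen q (E i)) =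
      qpow q 2 • ((φ ∘ₗ ρ (gen q (L i)) ∘ₗ ρ (gen q (E i))) ∘ₗ ρ (gen q (K i))) :=
    LinearMap.ext fun x => by
      have := rho_KE ρ i i x
      rw [cartanA_self] at this
      simp only [LinearMap.smul_apply, LinearMap.comp_apply, ← map_smul, ← this, rho_LK]
  rw [h2, LinearMap.map_smul, map_smul, hK, smul_smul, ← qpow_add] at h1
  rw [neg_smul, eq_neg_iff_add_eq_zero, add_comm, ← h1]

/-- Contraction of a highest weight vector with the top coordinate of the right factor. -/
theorem exists_weightVector_left [FiniteDimensional ℂ V] (hq : ∀ n : ℕ, 0 < n → (q : ℂ) ^ n ≠ 1)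
    (ha : IsHighestWeight ρ (fun i => d i) a) (ha0 : a ≠ 0) (hρ : IsIrreducibleAction ρ)
    (e : Fin (N - 1) → ℤ) (u : W ⊗[ℂ] V) (hu0 : u ≠ 0)
    (hu : IsHighestWeight (UqRep.tensorAction σ ρ) e u) :
    ∃ b : W, b ≠ 0 ∧ ∀ i, σ (gen q (K i)) b = qpow q (e i - d i) • b ∧
      (σ (gen q (E i)) ^ (d i + 1)) b = 0 := by
  have hK : ∀ i φ, σ (gen q (K i)) (contractSnd u (φ ∘ₗ ρ (gen q (K i)))) =
      qpow q (e i) • contractSnd u φ := fun i φ => by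
    rw [← contractSnd_map, ← tensorAction_K, (hu i).2, contractSnd_smul, LinearMap.smul_apply]
  refine exists_weightVector_of_contraction hq ha ha0 hρ e (contractSnd u)
    (contractSnd_ne_zero hu0) (fun _ => -1) (fun _ => neg_ne_zero.mpr one_ne_zero)
    (fun i φ => ?_) hK
  have h1 := congrArg (fun w => contractSnd w (φ ∘ₗ ρ (gen q (L i)))) (tensorAction_E σ ρ i u)
  have h2 : (φ ∘ₗ ρ (gen q (L i))) ∘ₗ ρ (gen q (K i)) = φ :=
    LinearMap.ext fun x => by simp [rho_LK]
  simp only [(hu i).1, contractSnd_add, LinearMap.add_apply, contractSnd_map, h2,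
    contractSnd_zero, LinearMap.zero_apply, LinearMap.id_apply, LinearMap.comp_assoc] at h1
  rw [neg_one_smul, eq_neg_iff_add_eq_zero, ← h1]

end Contraction

/-! ### Weight vectors in a factor of a tensor product -/

section Occurrence

variable {N : ℕ} {q : ℂˣ}

theorem UqRep.IsIrrep.exists_highestWeight {A : UqRep N q} {lam : Diagram N} (h : A.IsIrrep lam) :
    ∃ v : A.V, v ≠ 0 ∧ IsHighestWeight A.ρ (fun i => lam.dynkin i) v := by
  obtain ⟨_, _, v, hv, hv'⟩ := h
  refine ⟨v, hv, fun i => ⟨(hv' i).1, ?_⟩⟩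
  rw [(hv' i).2]
  simp [qpow]

/-- An intertwiner out of an irreducible representation is injective on highest weight vectors. -/
theorem exists_highestWeight_tensor {A B C : UqRep N q} {nu : Diagram N} (hC : C.IsIrrep nu)
    (h : UqRep.multiplicitySpace A B C ≠ ⊥) : ∃ u : A.V ⊗[ℂ] B.V, u ≠ 0 ∧
      IsHighestWeight (UqRep.tensorAction A.ρ B.ρ) (fun i => nu.dynkin i) u := by
  obtain ⟨(f : C.V →ₗ[ℂ] A.V ⊗[ℂ] B.V), hf, (hf0 : f ≠ 0)⟩ :=
    Submodule.exists_mem_ne_zero_of_ne_bot h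
  have hcomm : ∀ (u : Uq N q) (x : C.V), f (C.ρ u x) = UqRep.tensorAction A.ρ B.ρ u (f x) :=
    fun u x => LinearMap.congr_fun (hf u) x
  obtain ⟨c, hc, hcw⟩ := hC.exists_highestWeight
  refine ⟨f c, fun h0 => ?_, fun i => ⟨?_, ?_⟩⟩
  · have hker := hC.1.2 (LinearMap.ker f) fun u x hx => by
      rw [LinearMap.mem_ker, hcomm, LinearMap.mem_ker.mp hx, map_zero]
    rcases hker with hker | hker
    · exact hc ((Submodule.mem_bot ℂ).mp (hker ▸ LinearMap.mem_ker.mpr h0))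
    · exact hf0 (LinearMap.ker_eq_top.mp hker)
  · rw [← hcomm, (hcw i).1, map_zero]
  · rw [← hcomm, (hcw i).2, map_smul]

/-- The representation `B` has a nonzero vector of weight `nu - lam` which is killed by
`E i ^ (lam i + 1)` for every `i`. -/
def HasStepVector (B : UqRep N q) (nu lam : Diagram N) : Prop :=
  ∃ b : B.V, b ≠ 0 ∧ ∀ i, B.ρ (gen q (K i)) b = qpow q (nu.dynkin i - lam.dynkin i) • b ∧
    (B.ρ (gen q (E i)) ^ (lam.dynkin i + 1)) b = 0

theorem Occurs.exists_stepVector_right (hq : ∀ n : ℕ, 0 < n → (q : ℂ) ^ n ≠ 1)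
    {nu lam mu : Diagram N} (h : Occurs q nu lam mu) :
    ∃ B : UqRep N q, B.IsIrrep mu ∧ HasStepVector B nu lam := by
  obtain ⟨A, B, C, hA, hB, hC, hne⟩ := h
  obtain ⟨u, hu0, hu⟩ := exists_highestWeight_tensor hC hne
  obtain ⟨a, ha0, ha⟩ := hA.exists_highestWeight
  have := hA.2.1
  exact ⟨B, hB, exists_weightVector_right hq ha ha0 hA.1.2 _ u hu0 hu⟩

theorem Occurs.exists_stepVector_left (hq : ∀ n : ℕ, 0 < n → (q : ℂ) ^ n ≠ 1)
    {nu lam mu : Diagram N} (h : Occurs q nu lam mu) :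
    ∃ A : UqRep N q, A.IsIrrep lam ∧ HasStepVector A nu mu := by
  obtain ⟨A, B, C, hA, hB, hC, hne⟩ := h
  obtain ⟨u, hu0, hu⟩ := exists_highestWeight_tensor hC hne
  obtain ⟨b, hb0, hb⟩ := hB.exists_highestWeight
  have := hB.2.1
  exact ⟨A, hA, exists_weightVector_left hq hb hb0 hB.1.2 _ u hu0 hu⟩

end Occurrence

/-! ### A polynomial model of the symmetric representations -/

section Model

variable {N : ℕ} {q : ℂˣ}

/-- A map on the generators that respects the defining relations extends to `U_q(sl_N)`. -/
noncomputable def Uq.lift {A : Type*} [Ring A] [Algebra ℂ A] (g : UqGen N → A)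
    (h : ∀ a b, UqRel N q a b → FreeAlgebra.lift ℂ g a = FreeAlgebra.lift ℂ g b) : Uq N q →ₐ[ℂ] A :=
  RingQuot.liftAlgHom ℂ ⟨FreeAlgebra.lift ℂ g, fun a b hab => h a b hab⟩

theorem Uq.lift_gen {A : Type*} [Ring A] [Algebra ℂ A] (g : UqGen N → A)
    (h : ∀ a b, UqRel N q a b → FreeAlgebra.lift ℂ g a = FreeAlgebra.lift ℂ g b) (x : UqGen N) :
    Uq.lift g h (gen q x) = g x := by
  simp [Uq.lift, gen]

/-- The simple root `e_i - e_{i+1}`, as an exponent vector. -/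
def simpleRoot (i : ℕ) : ℕ → ℤ := Pi.single i 1 - Pi.single (i + 1) 1

theorem simpleRoot_apply (i k : ℕ) :
    simpleRoot i k = (if k = i then 1 else 0) - (if k = i + 1 then 1 else 0) := by
  simp [simpleRoot, Pi.single_apply]

/-- The operator `f ↦ (m ↦ c m * f (m + s))` on functions of exponent vectors. -/
def weightedShift (c : (ℕ → ℤ) → ℂ) (s : ℕ → ℤ) : Module.End ℂ ((ℕ → ℤ) → ℂ) where
  toFun f m := c m * f (m + s)
  map_add' f g := by
    funext m
    simp [mul_add]
  map_smul' a f := by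
    funext m
    simp
    ring

theorem weightedShift_apply (c : (ℕ → ℤ) → ℂ) (s : ℕ → ℤ) (f : (ℕ → ℤ) → ℂ) (m : ℕ → ℤ) :
    weightedShift c s f m = c m * f (m + s) := rfl

/-- The generators on formal combinations `∑ f m x ^ m` of Laurent monomials in `x₀, x₁, …`:
`E i x ^ m = [m (i + 1)] x ^ (m + e_i - e_{i+1})`, `F i x ^ m = [m i] x ^ (m - e_i + e_{i+1})` and
`K i x ^ m = q ^ (m i - m (i + 1)) x ^ m`. Negative exponents are allowed so that the relations hold
without boundary cases. -/
noncomputable def modelGen (N : ℕ) (q : ℂˣ) : UqGen N → Module.End ℂ ((ℕ → ℤ) → ℂ)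
  | E i => weightedShift (fun m => qint q (m (i + 1) + 1)) (-simpleRoot i)
  | F i => weightedShift (fun m => qint q (m i + 1)) (simpleRoot i)
  | K i => weightedShift (fun m => qpow q (m i - m (i + 1))) 0
  | L i => weightedShift (fun m => qpow q (m (i + 1) - m i)) 0

theorem qpow_sub' (q : ℂˣ) (a b : ℤ) : qpow q (a - b) = qpow q a * qpow q (-b) := by
  rw [sub_eq_add_neg, qpow_add]

/-- The identity of quantum integers behind the quantum Serre relations in the polynomial model. -/
theorem qint_serre (q : ℂˣ) (a : ℤ) :
    qint q (a + 1) - (qpow q 1 + qpow q (-1)) * qint q a + qint q (a - 1) = 0 := by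
  simp only [qint, neg_add, neg_sub', qpow_sub', qpow_add, neg_neg]
  ring

/-- The identity of quantum integers behind `[E i, F i]` in the polynomial model. -/
theorem qint_commutator (hq : ∀ n : ℕ, 0 < n → (q : ℂ) ^ n ≠ 1) (a b : ℤ) :
    qint q (b + 1) * qint q a - qint q (a + 1) * qint q b = qint q (a - b) := by
  have h : qpow q 1 - qpow q (-1) ≠ 0 := fun h => by
    have := qpow_injective hq (sub_eq_zero.mp h)
    omega
  simp only [qint, neg_add, neg_sub', qpow_sub', qpow_add, neg_neg]
  field_simp
  ring

theorem weightedShift_mul_apply (c c' : (ℕ → ℤ) → ℂ) (s s' : ℕ → ℤ) (f : (ℕ → ℤ) → ℂ)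
    (m : ℕ → ℤ) : (weightedShift c s * weightedShift c' s') f m =
      c m * c' (m + s) * f (m + (s + s')) := by
  rw [Module.End.mul_apply, weightedShift_apply, weightedShift_apply, mul_assoc, add_assoc]

theorem weightedShift_mul (c c' : (ℕ → ℤ) → ℂ) (s s' : ℕ → ℤ) :
    weightedShift c s * weightedShift c' s' = weightedShift (fun m => c m * c' (m + s)) (s + s') :=
  LinearMap.ext fun f => funext fun m => weightedShift_mul_apply c c' s s' f m

theorem weightedShift_smul (a : ℂ) (c : (ℕ → ℤ) → ℂ) (s : ℕ → ℤ) :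
    a • weightedShift c s = weightedShift (fun m => a * c m) s :=
  LinearMap.ext fun f => funext fun m => by
    simp [weightedShift_apply, mul_assoc]

theorem weightedShift_add (c c' : (ℕ → ℤ) → ℂ) (s : ℕ → ℤ) :
    weightedShift c s + weightedShift c' s = weightedShift (fun m => c m + c' m) s :=
  LinearMap.ext fun f => funext fun m => by
    simp [weightedShift_apply, add_mul]

theorem weightedShift_sub (c c' : (ℕ → ℤ) → ℂ) (s : ℕ → ℤ) :
    weightedShift c s - weightedShift c' s = weightedShift (fun m => c m - c' m) s :=
  LinearMap.ext fun f => funext fun m => by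
    simp [weightedShift_apply, sub_mul]

theorem weightedShift_eq {c c' : (ℕ → ℤ) → ℂ} {s s' : ℕ → ℤ} (hs : s = s')
    (hc : ∀ m, c m = c' m) : weightedShift c s = weightedShift c' s' := by
  rw [hs, funext hc]

theorem weightedShift_one : weightedShift 1 0 = 1 :=
  LinearMap.ext fun f => funext fun m => by simp [weightedShift_apply]

theorem cartanA_eq_simpleRoot (i j : Fin (N - 1)) :
    cartanA i j = simpleRoot j i - simpleRoot j (i + 1) := by
  simp only [cartanA, AdjRoots, Fin.ext_iff, simpleRoot_apply]
  split_ifs <;> omega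

theorem modelGen_rel (hq : ∀ n : ℕ, 0 < n → (q : ℂ) ^ n ≠ 1)
    (a b : FreeAlgebra ℂ (UqGen N)) (h : UqRel N q a b) :
    FreeAlgebra.lift ℂ (modelGen N q) a = FreeAlgebra.lift ℂ (modelGen N q) b := by
  induction h with
  | KL i =>
    simp only [map_mul, map_one, FreeAlgebra.lift_ι_apply, modelGen, weightedShift_mul,
      ← weightedShift_one]
    refine weightedShift_eq (by simp) fun m => ?_
    simp [← qpow_add, qpow_zero]
  | LK i =>
    simp only [map_mul, map_one, FreeAlgebra.lift_ι_apply, modelGen, weightedShift_mul,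
      ← weightedShift_one]
    refine weightedShift_eq (by simp) fun m => ?_
    simp [← qpow_add, qpow_zero]
  | KK i j =>
    simp only [map_mul, FreeAlgebra.lift_ι_apply, modelGen, weightedShift_mul]
    refine weightedShift_eq rfl fun m => ?_
    simp [mul_comm]
  | KE i j =>
    simp only [map_mul, map_smul, FreeAlgebra.lift_ι_apply, modelGen, weightedShift_mul,
      weightedShift_smul, cartanA_eq_simpleRoot]
    refine weightedShift_eq (by simp) fun m => ?_
    simp only [Pi.add_apply, Pi.neg_apply, Pi.zero_apply, add_zero]
    rw [mul_left_comm, ← qpow_add, mul_comm]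
    congr 2
    ring
  | KF i j =>
    simp only [map_mul, map_smul, FreeAlgebra.lift_ι_apply, modelGen, weightedShift_mul,
      weightedShift_smul, cartanA_eq_simpleRoot]
    refine weightedShift_eq (by simp) fun m => ?_
    simp only [Pi.add_apply, Pi.zero_apply, add_zero]
    rw [mul_left_comm, ← qpow_add, mul_comm]
    congr 2
    ring
  | EF i =>
    simp only [map_mul, map_smul, map_sub, FreeAlgebra.lift_ι_apply, modelGen, weightedShift_mul,
      weightedShift_smul, neg_add_cancel, add_neg_cancel, weightedShift_sub]
    refine weightedShift_eq rfl fun m => ?_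
    have := qint_commutator hq (m i) (m (i + 1))
    rw [qint.eq_1 q (m i - m (i + 1)), neg_sub] at this
    simp [simpleRoot_apply, ← this]
  | EF_ne i j h =>
    simp only [map_mul, FreeAlgebra.lift_ι_apply, modelGen, weightedShift_mul]
    refine weightedShift_eq (add_comm _ _) fun m => ?_
    have hij : i.val ≠ j.val := fun e => h (Fin.ext e)
    simp only [Pi.add_apply, Pi.neg_apply, simpleRoot_apply]
    by_cases h1 : j.val = i.val + 1
    · rw [h1]
      simp
    · simp [h1, hij, hij.symm, Ne.symm h1]
      ring
  | EE i j h h' =>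
    have hij : i.val ≠ j.val := fun e => h (Fin.ext e)
    unfold AdjRoots at h'
    simp only [map_mul, FreeAlgebra.lift_ι_apply, modelGen, weightedShift_mul]
    refine weightedShift_eq (add_comm _ _) fun m => ?_
    have e1 : simpleRoot i (j + 1) = 0 := by
      rw [simpleRoot_apply, if_neg (by omega), if_neg (by omega), sub_zero]
    have e2 : simpleRoot j (i + 1) = 0 := by
      rw [simpleRoot_apply, if_neg (by omega), if_neg (by omega), sub_zero]
    simp [e1, e2, mul_comm]
  | FF i j h h' =>
    have hij : i.val ≠ j.val := fun e => h (Fin.ext e)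
    unfold AdjRoots at h'
    simp only [map_mul, FreeAlgebra.lift_ι_apply, modelGen, weightedShift_mul]
    refine weightedShift_eq (add_comm _ _) fun m => ?_
    have e1 : simpleRoot i j = 0 := by
      rw [simpleRoot_apply, if_neg (by omega), if_neg (by omega), sub_zero]
    have e2 : simpleRoot j i = 0 := by
      rw [simpleRoot_apply, if_neg (by omega), if_neg (by omega), sub_zero]
    simp [e1, e2, mul_comm]
  | serreE i j h =>
    simp only [serre, map_add, map_sub, map_mul, map_smul, map_zero, FreeAlgebra.lift_ι_apply,
      modelGen, weightedShift_mul, weightedShift_smul]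
    have s1 : -simpleRoot i + -simpleRoot j + -simpleRoot i =
        -simpleRoot i + -simpleRoot i + -simpleRoot j := by abel
    have s2 : -simpleRoot j + -simpleRoot i + -simpleRoot i =
        -simpleRoot i + -simpleRoot i + -simpleRoot j := by abel
    rw [s1, s2, weightedShift_sub, weightedShift_add]
    refine LinearMap.ext fun f => funext fun m => ?_
    rw [weightedShift_apply]
    simp only [Pi.add_apply, Pi.neg_apply, simpleRoot_apply]
    refine mul_eq_zero_of_left ?_ _
    have a1 : ∀ k : ℕ, k + 1 + 1 ≠ k := fun k => by omega
    have a3 : ∀ z : ℤ, z + -2 + 1 = z - 1 := fun z => by ring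
    rcases h with h | h
    · have := qint_serre q (m (j : ℕ) + 1)
      rw [← h] at this ⊢
      simp [a1] at this ⊢
      linear_combination (qint q (m (i + 1) + 1) * qint q (m (i + 1 + 1) + 1)) * this
    · have := qint_serre q (m (i : ℕ))
      rw [← h] at this ⊢
      simp [a1, a3] at this ⊢
      linear_combination (qint q (m (j + 1 + 1) + 1) * qint q (m (j + 1 + 1) + 1 + 1)) * this
  | serreF i j h =>
    simp only [serre, map_add, map_sub, map_mul, map_smul, map_zero, FreeAlgebra.lift_ι_apply,
      modelGen, weightedShift_mul, weightedShift_smul]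
    have s1 : simpleRoot i + simpleRoot j + simpleRoot i =
        simpleRoot i + simpleRoot i + simpleRoot j := by abel
    have s2 : simpleRoot j + simpleRoot i + simpleRoot i =
        simpleRoot i + simpleRoot i + simpleRoot j := by abel
    rw [s1, s2, weightedShift_sub, weightedShift_add]
    refine LinearMap.ext fun f => funext fun m => ?_
    rw [weightedShift_apply]
    simp only [Pi.add_apply, simpleRoot_apply]
    refine mul_eq_zero_of_left ?_ _
    have a1 : ∀ k : ℕ, k ≠ k + 1 + 1 := fun k => by omega
    have a3 : ∀ z : ℤ, z + -2 + 1 = z - 1 := fun z => by ring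
    rcases h with h | h
    · have := qint_serre q (m (j : ℕ))
      rw [← h] at this ⊢
      simp [a1, a3] at this ⊢
      linear_combination (qint q (m i + 1) * qint q (m i + 1 + 1)) * this
    · have := qint_serre q (m (i : ℕ) + 1)
      rw [← h] at this ⊢
      simp [a1] at this ⊢
      linear_combination (qint q (m j + 1) * qint q (m (j + 1) + 1)) * this

/-- The action of `U_q(sl_N)` on formal combinations of Laurent monomials. -/
noncomputable def modelAction (N : ℕ) {q : ℂˣ} (hq : ∀ n : ℕ, 0 < n → (q : ℂ) ^ n ≠ 1) :
    Uq N q →ₐ[ℂ] Module.End ℂ ((ℕ → ℤ) → ℂ) :=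
  Uq.lift (modelGen N q) (modelGen_rel hq)

theorem modelAction_gen (hq : ∀ n : ℕ, 0 < n → (q : ℂ) ^ n ≠ 1) (x : UqGen N) :
    modelAction N hq (gen q x) = modelGen N q x :=
  Uq.lift_gen _ _ x

end Model

/-! ### Weight vectors in the symmetric representations -/

section Symmetric

variable {N : ℕ} {q : ℂˣ}

/-- Exponent vectors of the monomials of degree `r` in `x₀, …, x_{N-1}`. -/
def IsExponent (N r : ℕ) (m : ℕ → ℤ) : Prop :=
  (∀ k, 0 ≤ m k) ∧ (∀ k, N ≤ k → m k = 0) ∧ ∑ k ∈ Finset.range N, m k = r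

/-- The combinations of monomials of degree `r` in `x₀, …, x_{N-1}`. -/
def homogeneous (N r : ℕ) : Submodule ℂ ((ℕ → ℤ) → ℂ) where
  carrier := {f | ∀ m, f m ≠ 0 → IsExponent N r m}
  add_mem' {f g} hf hg m h := by
    by_cases h0 : f m = 0
    · exact hg m fun h1 => h (by simp [h0, h1])
    · exact hf m h0
  zero_mem' m h := absurd rfl h
  smul_mem' c f hf m h := hf m fun h0 => h (by simp [h0])

/-- The highest weight vector `x₀ ^ r`. -/
noncomputable def topMonomial (r : ℕ) : (ℕ → ℤ) → ℂ := by
  classical exact Pi.single (Pi.single 0 (r : ℤ)) 1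

theorem topMonomial_self (r : ℕ) : topMonomial r (Pi.single 0 (r : ℤ)) = 1 := by
  simp [topMonomial]

theorem topMonomial_of_ne {r : ℕ} {m : ℕ → ℤ} (h : m ≠ Pi.single 0 (r : ℤ)) :
    topMonomial r m = 0 := by
  simp [topMonomial, h]

theorem topMonomial_mem (hN : 0 < N) (r : ℕ) : topMonomial r ∈ homogeneous N r := by
  intro m hm
  have : m = Pi.single 0 (r : ℤ) := by
    by_contra h
    exact hm (topMonomial_of_ne h)
  subst this
  refine ⟨fun k => ?_, fun k hk => ?_, ?_⟩
  · by_cases h : k = 0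
    · subst h
      simp
    · simp [h]
  · rw [Pi.single_eq_of_ne (by omega)]
  · rw [Finset.sum_eq_single 0 (fun k _ hk => Pi.single_eq_of_ne hk _)
      (fun h => absurd (Finset.mem_range.mpr hN) h), Pi.single_eq_same]

theorem sum_mul_simpleRoot (i : Fin (N - 1)) (g : ℕ → ℤ) :
    ∑ k ∈ Finset.range N, g k * simpleRoot i k = g i - g (i + 1) := by
  have hi := i.isLt
  simp only [simpleRoot_apply, mul_sub, mul_ite, mul_one, mul_zero, Finset.sum_sub_distrib,
    Finset.sum_ite_eq', Finset.mem_range]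
  rw [if_pos (by omega), if_pos (by omega)]

theorem sum_simpleRoot (i : Fin (N - 1)) : ∑ k ∈ Finset.range N, simpleRoot i k = 0 := by
  simpa using sum_mul_simpleRoot i fun _ => 1

/-- The homogeneous polynomials are stable inside all Laurent combinations, since the coefficients
`[m i]` vanish where an exponent would become negative. -/
theorem modelGen_mem_homogeneous (hq : ∀ n : ℕ, 0 < n → (q : ℂ) ^ n ≠ 1) (r : ℕ) (g : UqGen N) :
    ∀ f ∈ homogeneous N r, modelAction N hq (gen q g) f ∈ homogeneous N r := by
  intro f hf m hm
  rw [modelAction_gen] at hm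
  have hqz : ∀ a : ℤ, qint q a ≠ 0 → a ≠ 0 := by
    rintro a ha rfl
    exact ha (qint_zero q)
  rcases g with i | i | i | i
  · have hi := i.isLt
    obtain ⟨h1, h2, h3⟩ := hf _ (right_ne_zero_of_mul hm)
    have h4 := hqz _ (left_ne_zero_of_mul hm)
    simp only [Pi.add_apply, Pi.neg_apply, Finset.sum_add_distrib, Finset.sum_neg_distrib,
      sum_simpleRoot] at h1 h2 h3
    refine ⟨fun k => ?_, fun k hk => ?_, by simpa using h3⟩
    · have h5 := h1 k
      have h6 := h1 (i + 1)
      rw [simpleRoot_apply] at h5 h6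
      by_cases hk : k = i + 1
      · subst hk
        simp at h6
        omega
      · rw [if_neg hk] at h5
        split_ifs at h5 <;> omega
    · have h5 := h2 k hk
      rw [simpleRoot_apply, if_neg (by omega), if_neg (by omega)] at h5
      simpa using h5
  · have hi := i.isLt
    obtain ⟨h1, h2, h3⟩ := hf _ (right_ne_zero_of_mul hm)
    have h4 := hqz _ (left_ne_zero_of_mul hm)
    simp only [Pi.add_apply, Finset.sum_add_distrib, sum_simpleRoot] at h1 h2 h3
    refine ⟨fun k => ?_, fun k hk => ?_, by simpa using h3⟩
    · have h5 := h1 k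
      have h6 := h1 i
      rw [simpleRoot_apply] at h5 h6
      by_cases hk : k = i
      · subst hk
        simp at h6
        omega
      · rw [if_neg hk] at h5
        split_ifs at h5 <;> omega
    · have h5 := h2 k hk
      rw [simpleRoot_apply, if_neg (by omega), if_neg (by omega)] at h5
      simpa using h5
  · simpa using hf _ (right_ne_zero_of_mul hm)
  · simpa using hf _ (right_ne_zero_of_mul hm)

theorem eq_single_of_isExponent {r : ℕ} {m : ℕ → ℤ} (hN : 0 < N) (h : IsExponent N r m)
    (h0 : ∀ i : Fin (N - 1), m (i + 1) = 0) : m = Pi.single 0 (r : ℤ) := by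
  obtain ⟨_, h2, h3⟩ := h
  have hz : ∀ k, k ≠ 0 → m k = 0 := fun k hk => by
    by_cases hkN : N ≤ k
    · exact h2 k hkN
    · simpa [Nat.sub_add_cancel (Nat.one_le_iff_ne_zero.mpr hk)] using h0 ⟨k - 1, by omega⟩
  rw [Finset.sum_eq_single 0 (fun k _ hk => hz k hk)
    (fun h => absurd (Finset.mem_range.mpr hN) h)] at h3
  funext k
  by_cases hk : k = 0
  · subst hk
    simpa using h3
  · rw [hz k hk, Pi.single_eq_of_ne hk]

/-- Every nonzero homogeneous element generates the top monomial: apply the `E i` as long as one of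
them does not kill it. -/
theorem exists_modelAction_eq_topMonomial (hq : ∀ n : ℕ, 0 < n → (q : ℂ) ^ n ≠ 1) (hN : 0 < N)
    {r : ℕ} {f : (ℕ → ℤ) → ℂ} (hf : f ∈ homogeneous N r) (hf0 : f ≠ 0) :
    ∃ u, modelAction N hq u f = topMonomial r := by
  have key : ∀ n : ℕ, ∀ f ∈ homogeneous N r, f ≠ 0 →
      (∀ m, f m ≠ 0 → ∑ k ∈ Finset.range N, (k : ℤ) * m k < n) →
      ∃ u, modelAction N hq u f = topMonomial r := by
    intro n
    induction n with
    | zero =>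
      intro f hf hf0 hn
      obtain ⟨m, hm⟩ := Function.ne_iff.mp hf0
      have h1 := hn m hm
      have h2 : 0 ≤ ∑ k ∈ Finset.range N, (k : ℤ) * m k :=
        Finset.sum_nonneg fun k _ => mul_nonneg (by positivity) ((hf m hm).1 k)
      exact absurd h1 (by simpa using h2)
    | succ n ih =>
      intro f hf hf0 hn
      by_cases hE : ∃ i : Fin (N - 1), modelAction N hq (gen q (E i)) f ≠ 0
      · obtain ⟨i, hi⟩ := hE
        obtain ⟨u, hu⟩ := ih _ (modelGen_mem_homogeneous hq r (E i) f hf) hi fun m hm => by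
          rw [modelAction_gen] at hm
          have h1 := hn _ (right_ne_zero_of_mul hm)
          simp only [Pi.add_apply, Pi.neg_apply, mul_add, mul_neg, Finset.sum_add_distrib,
            Finset.sum_neg_distrib, sum_mul_simpleRoot i fun k => (k : ℤ)] at h1
          push_cast at h1
          omega
        exact ⟨u * gen q (E i), by rw [map_mul, Module.End.mul_apply, hu]⟩
      · push Not at hE
        have h1 : ∀ m, f m ≠ 0 → m = Pi.single 0 (r : ℤ) := fun m hm =>
          eq_single_of_isExponent hN (hf m hm) fun i => by
            have h2 := congrFun (hE i) (m + simpleRoot i)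
            rw [modelAction_gen] at h2
            have h3 : qint q ((m + simpleRoot i) (i + 1) + 1) * f (m + simpleRoot i + -simpleRoot i)
              = 0 := h2
            rw [add_neg_cancel_right] at h3
            have h4 := (mul_eq_zero.mp h3).resolve_right hm
            by_contra h5
            refine qint_ne_zero hq ?_ h4
            simpa [simpleRoot_apply] using h5
        have h2 : f (Pi.single 0 (r : ℤ)) ≠ 0 := by
          obtain ⟨m, hm⟩ := Function.ne_iff.mp hf0
          rwa [h1 m hm] at hm
        refine ⟨algebraMap ℂ _ (f (Pi.single 0 (r : ℤ)))⁻¹, ?_⟩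
        rw [AlgHom.commutes]
        funext m
        by_cases hm : m = Pi.single 0 (r : ℤ)
        · subst hm
          simp [topMonomial_self, h2]
        · have : f m = 0 := by
            by_contra h
            exact hm (h1 m h)
          simp [topMonomial_of_ne hm, this]
  -- exponents of degree `r` have `∑ k * m k ≤ N * r`, and each `E i` lowers this sum by one
  refine key (N * r + 1) f hf hf0 fun m hm => ?_
  obtain ⟨h1, _, h3⟩ := hf m hm
  have : ∑ k ∈ Finset.range N, (k : ℤ) * m k ≤ ∑ k ∈ Finset.range N, (N : ℤ) * m k :=
    Finset.sum_le_sum fun k hk => mul_le_mul_of_nonneg_right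
      (by exact_mod_cast (Finset.mem_range.mp hk).le) (h1 k)
  rw [← Finset.mul_sum, h3] at this
  push_cast
  omega

/-- The Dynkin labels of the one-row diagram `[r]`. -/
def symLabel (N r : ℕ) (i : Fin (N - 1)) : ℤ := if i.val = 0 then r else 0

theorem topMonomial_isHighestWeight (hq : ∀ n : ℕ, 0 < n → (q : ℂ) ^ n ≠ 1) (r : ℕ) :
    IsHighestWeight (modelAction N hq) (symLabel N r) (topMonomial r) := by
  refine fun i => ⟨funext fun m => ?_, funext fun m => ?_⟩
  · rw [modelAction_gen, modelGen, weightedShift_apply]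
    by_cases hm : m + -simpleRoot i = Pi.single 0 (r : ℤ)
    · have h1 := congrFun hm (i + 1)
      simp [simpleRoot_apply] at h1
      rw [h1, qint_zero, zero_mul]
      rfl
    · rw [topMonomial_of_ne hm, mul_zero]
      rfl
  · rw [modelAction_gen, modelGen, weightedShift_apply, add_zero, Pi.smul_apply, smul_eq_mul]
    by_cases hm : m = Pi.single 0 (r : ℤ)
    · subst hm
      simp [symLabel, Pi.single_apply]
    · rw [topMonomial_of_ne hm, mul_zero, mul_zero]

variable {V : Type*} [AddCommGroup V] [Module ℂ V] {ρ : Uq N q →ₐ[ℂ] Module.End ℂ V} {v : V}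
  {r : ℕ}

/-- The action on a direct sum. -/
noncomputable def prodAction {V W : Type*} [AddCommGroup V] [Module ℂ V] [AddCommGroup W]
    [Module ℂ W] (ρ : Uq N q →ₐ[ℂ] Module.End ℂ V) (σ : Uq N q →ₐ[ℂ] Module.End ℂ W) :
    Uq N q →ₐ[ℂ] Module.End ℂ (V × W) :=
  (LinearMap.prodMapAlgHom ℂ V W).comp (ρ.prod σ)

theorem prodAction_apply {V W : Type*} [AddCommGroup V] [Module ℂ V] [AddCommGroup W]
    [Module ℂ W] (ρ : Uq N q →ₐ[ℂ] Module.End ℂ V) (σ : Uq N q →ₐ[ℂ] Module.End ℂ W)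
    (u : Uq N q) (x : V × W) : prodAction ρ σ u x = (ρ u x.1, σ u x.2) := rfl

/-- The top coordinate of `u v` depends on `u` only, not on the module: in the direct sum with the
model, `u (v, x₀ ^ r)` is a combination of words in the `F i` applied to `(v, x₀ ^ r)`, and every
nonempty word has top coordinate zero in both components. -/
theorem coordinate_eq_modelAction (hq : ∀ n : ℕ, 0 < n → (q : ℂ) ^ n ≠ 1) (hN : 0 < N)
    (hv : IsHighestWeight ρ (symLabel N r) v) {π : Module.Dual ℂ V} (hπv : π v = 1)
    (hπ : IsTopCoordinate ρ (symLabel N r) π) (u : Uq N q) :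
    π (ρ u v) = modelAction N hq u (topMonomial r) (Pi.single 0 (r : ℤ)) := by
  set σ := modelAction N hq with hσ
  have hw := topMonomial_isHighestWeight (N := N) hq r
  have hvw : IsHighestWeight (prodAction ρ σ) (symLabel N r) (v, topMonomial r) := fun i => by
    simp only [prodAction_apply, (hv i).1, (hv i).2, (hw i).1, (hw i).2, Prod.smul_mk,
      Prod.mk_zero_zero, and_self, hσ]
  have hS : ∀ l, (lowered (prodAction ρ σ) (v, topMonomial r) l).2 ∈ homogeneous N r := by
    intro l
    induction l with
    | nil => exact topMonomial_mem hN r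
    | cons i l ih =>
      rw [lowered, prodAction_apply]
      exact modelGen_mem_homogeneous hq r (F i) _ ih
  have key : ∀ x ∈ Submodule.span ℂ (Set.range (lowered (prodAction ρ σ) (v, topMonomial r))),
      π x.1 = x.2 (Pi.single 0 (r : ℤ)) := by
    intro x hx
    induction hx using Submodule.span_induction with
    | mem x hx =>
      obtain ⟨l, rfl⟩ := hx
      cases l with
      | nil => simp [lowered, hπv, topMonomial_self]
      | cons i l =>
        rw [lowered, prodAction_apply]
        dsimp only
        rw [hπ.apply_F, hσ, modelAction_gen, modelGen, weightedShift_apply]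
        by_contra h
        have h1 := (hS l _ (right_ne_zero_of_mul (Ne.symm h))).1 (i + 1)
        simp [simpleRoot_apply] at h1
    | zero => simp
    | add x y _ _ h1 h2 => simp [h1, h2]
    | smul c x _ h1 => simp [h1]
  exact key _ (hvw.mem_span_lowered u)

/-- The irreducible representation with the labels of `[r]` has the same annihilator of its highest
weight vector as the polynomial model. -/
theorem apply_eq_zero_iff_modelAction (hq : ∀ n : ℕ, 0 < n → (q : ℂ) ^ n ≠ 1) (hN : 0 < N)
    (hρ : IsIrreducibleAction ρ) (hv0 : v ≠ 0) (hv : IsHighestWeight ρ (symLabel N r) v)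
    (u : Uq N q) : ρ u v = 0 ↔ modelAction N hq u (topMonomial r) = 0 := by
  obtain ⟨π, hπv, hπ⟩ := hv.exists_coordinate hq hρ hv0
  have hc := coordinate_eq_modelAction hq hN hv hπv hπ
  constructor
  · intro h
    by_contra hne
    have hmem := mem_of_forall_gen (modelAction N hq) (homogeneous N r)
      (modelGen_mem_homogeneous hq r) u _ (topMonomial_mem hN r)
    obtain ⟨u', hu'⟩ := exists_modelAction_eq_topMonomial hq hN hmem hne
    have h1 := hc (u' * u)
    rw [map_mul, map_mul, Module.End.mul_apply, Module.End.mul_apply, h, hu', map_zero, map_zero,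
      topMonomial_self] at h1
    exact zero_ne_one h1
  · intro h
    by_contra hne
    obtain ⟨u', hu'⟩ := hρ.exists_apply_eq hne v
    have h1 := hc (u' * u)
    rw [map_mul, map_mul, Module.End.mul_apply, Module.End.mul_apply, h, hu', map_zero, hπv] at h1
    exact one_ne_zero h1

theorem modelAction_E_pow_ne_zero (hq : ∀ n : ℕ, 0 < n → (q : ℂ) ^ n ≠ 1) (i : Fin (N - 1))
    {f : (ℕ → ℤ) → ℂ} {m : ℕ → ℤ} (hm : f m ≠ 0) (n : ℕ) (hn : (n : ℤ) ≤ m (i + 1)) :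
    (modelAction N hq (gen q (E i)) ^ n) f (m + n • simpleRoot i) ≠ 0 := by
  induction n with
  | zero => simpa using hm
  | succ n ih =>
    rw [pow_succ', Module.End.mul_apply, modelAction_gen, modelGen, weightedShift_apply]
    push_cast at hn
    rw [← modelGen, ← modelAction_gen hq]
    refine mul_ne_zero (qint_ne_zero hq ?_) ?_
    · simp [simpleRoot_apply]
      omega
    · rw [add_assoc, succ_nsmul, add_neg_cancel_right]
      exact ih (by omega)

/-- The weights `e` of vectors `b` in the symmetric representation `[r]`, and a bound on the powers
of the `E i` that kill them. -/
theorem exists_isExponent_of_weightVector (hq : ∀ n : ℕ, 0 < n → (q : ℂ) ^ n ≠ 1) (hN : 0 < N)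
    (hρ : IsIrreducibleAction ρ) (hv0 : v ≠ 0) (hv : IsHighestWeight ρ (symLabel N r) v)
    {b : V} (hb : b ≠ 0) {e : Fin (N - 1) → ℤ} {n : Fin (N - 1) → ℕ}
    (hK : ∀ i, ρ (gen q (K i)) b = qpow q (e i) • b) (hE : ∀ i, (ρ (gen q (E i)) ^ n i) b = 0) :
    ∃ m, IsExponent N r m ∧ ∀ i : Fin (N - 1), e i = m i - m (i + 1) ∧ m (i + 1) < n i := by
  obtain ⟨u, rfl⟩ := hρ.exists_apply_eq hv0 b
  have hz := apply_eq_zero_iff_modelAction hq hN hρ hv0 hv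
  have hf0 : modelAction N hq u (topMonomial r) ≠ 0 := fun h => hb ((hz u).mpr h)
  have hmem := mem_of_forall_gen (modelAction N hq) (homogeneous N r)
    (modelGen_mem_homogeneous hq r) u _ (topMonomial_mem hN r)
  obtain ⟨m, hm⟩ := Function.ne_iff.mp hf0
  refine ⟨m, hmem m hm, fun i => ⟨?_, ?_⟩⟩
  · have h1 := (hz (gen q (K i) * u - qpow q (e i) • u)).mp (by simp [hK i])
    have h2 := congrFun h1 m
    rw [map_sub, map_mul, map_smul, LinearMap.sub_apply, Module.End.mul_apply, modelAction_gen,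
      modelGen, Pi.sub_apply, weightedShift_apply, add_zero, LinearMap.smul_apply, Pi.smul_apply,
      smul_eq_mul, ← sub_mul] at h2
    have h3 := (mul_eq_zero.mp h2).resolve_right hm
    exact (qpow_injective hq (sub_eq_zero.mp h3)).symm
  · have h1 := (hz (gen q (E i) ^ n i * u)).mp (by simp [hE i])
    by_contra h2
    refine modelAction_E_pow_ne_zero hq i hm (n i) (by omega) ?_
    rw [map_mul, map_pow, Module.End.mul_apply] at h1
    rw [h1]
    rfl

/-! ### The diagram automorphism -/

/-- The generator with the simple roots numbered backwards. -/
def revGen : UqGen N → UqGen N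
  | E i => E i.rev
  | F i => F i.rev
  | K i => K i.rev
  | L i => L i.rev

theorem adjRoots_rev {i j : Fin (N - 1)} : AdjRoots i.rev j.rev ↔ AdjRoots i j := by
  simp only [AdjRoots, Fin.val_rev]
  omega

theorem cartanA_rev (i j : Fin (N - 1)) : cartanA i.rev j.rev = cartanA i j := by
  simp only [cartanA, adjRoots_rev, Fin.rev_inj]

theorem revGen_rel (a b : FreeAlgebra ℂ (UqGen N)) (h : UqRel N q a b) :
    FreeAlgebra.lift ℂ (fun g => gen q (revGen g)) a =
      FreeAlgebra.lift ℂ (fun g => gen q (revGen g)) b := by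
  induction h with
  | KL i => simp [revGen, K_mul_L]
  | LK i => simp [revGen, L_mul_K]
  | KK i j => simp [revGen, K_mul_K i.rev]
  | KE i j => simp [revGen, K_mul_E, cartanA_rev]
  | KF i j => simp [revGen, K_mul_F, cartanA_rev]
  | EF i => simp [revGen, E_F_self]
  | EF_ne i j h => simp [revGen, E_mul_F_of_ne i.rev j.rev (by simpa using h)]
  | EE i j h h' =>
    simp [revGen, E_mul_E i.rev j.rev (by simpa using h) (by simpa [adjRoots_rev] using h')]
  | FF i j h h' =>
    simp [revGen, F_mul_F i.rev j.rev (by simpa using h) (by simpa [adjRoots_rev] using h')]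
  | serreE i j h =>
    have := serre_E (q := q) i.rev j.rev (adjRoots_rev.mpr h)
    rw [map_serre, map_zero]
    simpa [revGen] using this
  | serreF i j h =>
    have := serre_F (q := q) i.rev j.rev (adjRoots_rev.mpr h)
    rw [map_serre, map_zero]
    simpa [revGen] using this

/-- The automorphism of `U_q(sl_N)` given by the symmetry of the Dynkin diagram; it interchanges a
representation with its dual. -/
noncomputable def diagramAut (N : ℕ) (q : ℂˣ) : Uq N q →ₐ[ℂ] Uq N q :=
  Uq.lift (fun g => gen q (revGen g)) revGen_rel

theorem diagramAut_gen (g : UqGen N) : diagramAut N q (gen q g) = gen q (revGen g) :=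
  Uq.lift_gen _ _ g

theorem IsIrreducibleAction.comp_diagramAut (hρ : IsIrreducibleAction ρ) :
    IsIrreducibleAction (ρ.comp (diagramAut N q)) := by
  intro W hW
  refine hρ W (mem_of_forall_gen ρ W fun g x hx => ?_)
  have h1 := hW (gen q (revGen g)) x hx
  have h2 : revGen (revGen g) = g := by cases g <;> simp [revGen]
  rwa [AlgHom.comp_apply, diagramAut_gen, h2] at h1

/-- The counterpart for `[r]*` of `exists_isExponent_of_weightVector`. -/
theorem exists_isExponent_of_weightVector_rev (hq : ∀ n : ℕ, 0 < n → (q : ℂ) ^ n ≠ 1) (hN : 0 < N)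
    (hρ : IsIrreducibleAction ρ) (hv0 : v ≠ 0)
    (hv : IsHighestWeight ρ (fun i => symLabel N r i.rev) v)
    {b : V} (hb : b ≠ 0) {e : Fin (N - 1) → ℤ} {n : Fin (N - 1) → ℕ}
    (hK : ∀ i, ρ (gen q (K i)) b = qpow q (e i) • b) (hE : ∀ i, (ρ (gen q (E i)) ^ n i) b = 0) :
    ∃ m, IsExponent N r m ∧
      ∀ i : Fin (N - 1), e i.rev = m i - m (i + 1) ∧ m (i + 1) < n i.rev := by
  refine exists_isExponent_of_weightVector hq hN hρ.comp_diagramAut hv0 (fun i => ?_) hb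
    (fun i => ?_) (fun i => ?_)
  · simpa [AlgHom.comp_apply, diagramAut_gen, revGen] using hv i.rev
  · simpa [AlgHom.comp_apply, diagramAut_gen, revGen] using hK i.rev
  · simpa [AlgHom.comp_apply, diagramAut_gen, revGen] using hE i.rev

end Symmetric

/-! ### Dynkin labels of diagrams -/

/-- The Dynkin labels as a sequence of integers, extended by zero. -/
def Diagram.label {N : ℕ} (lam : Diagram N) (i : ℕ) : ℤ :=
  if h : i < N - 1 then lam.dynkin ⟨i, h⟩ else 0

/-- The labels in the opposite order; this is what passing to the dual does. -/
def revLabel (N : ℕ) (x : ℕ → ℤ) (i : ℕ) : ℤ := x (N - 2 - i)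

/-- `x` are the labels of the one-row diagram `[r]`. -/
def IsRow (N : ℕ) (r : ℤ) (x : ℕ → ℤ) : Prop := x 0 = r ∧ ∀ i, 0 < i → i < N - 1 → x i = 0

namespace Diagram

variable {N : ℕ}

theorem label_nonneg (lam : Diagram N) (i : ℕ) : 0 ≤ lam.label i := by
  unfold label
  split_ifs <;> omega

theorem label_val (lam : Diagram N) (i : Fin (N - 1)) : lam.label i = lam.dynkin i := by
  simp [label]

theorem label_eq_sub (lam : Diagram N) {i : ℕ} (h : i + 1 < N) :
    lam.label i = lam.row ⟨i, by omega⟩ - lam.row ⟨i + 1, h⟩ := by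
  have := lam.anti (show (⟨i, by omega⟩ : Fin N) ≤ ⟨i + 1, h⟩ from Nat.le_succ i)
  rw [label, dif_pos (by omega), dynkin]
  simp only
  omega

theorem label_injective {lam mu : Diagram N} (h : ∀ i < N - 1, lam.label i = mu.label i) :
    lam = mu := by
  have key : ∀ k (hk : k < N), lam.row ⟨N - 1 - k, by omega⟩ = mu.row ⟨N - 1 - k, by omega⟩ := by
    intro k
    induction k with
    | zero =>
      intro hk
      rw [lam.last _ (by simp only; omega), mu.last _ (by simp only; omega)]
    | succ k ih =>
      intro hk
      have h1 := ih (by omega)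
      have h2 := h (N - 1 - (k + 1)) (by omega)
      rw [label_eq_sub _ (by omega), label_eq_sub _ (by omega)] at h2
      have h3 : N - 1 - (k + 1) + 1 = N - 1 - k := by omega
      simp only [h3] at h2
      omega
  ext i
  have hi := i.isLt
  have := key (N - 1 - i) (by omega)
  have h3 : N - 1 - (N - 1 - i.val) = i.val := by omega
  simpa only [h3] using this

theorem label_conj (lam : Diagram N) {i : ℕ} (h : i < N - 1) :
    lam.conj.label i = revLabel N lam.label i := by
  rw [label_eq_sub _ (by omega), revLabel, label_eq_sub _ (by omega)]
  have e1 : (⟨i, by omega⟩ : Fin N).rev = ⟨N - 2 - i + 1, by omega⟩ := by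
    apply Fin.ext
    rw [Fin.val_rev]
    simp only
    omega
  have e2 : (⟨i + 1, by omega⟩ : Fin N).rev = ⟨N - 2 - i, by omega⟩ := by
    apply Fin.ext
    rw [Fin.val_rev]
    simp only
    omega
  have h1 := lam.anti (show (⟨0, by omega⟩ : Fin N) ≤ ⟨N - 2 - i + 1, by omega⟩ from Nat.zero_le _)
  have h2 := lam.anti (show (⟨0, by omega⟩ : Fin N) ≤ ⟨N - 2 - i, by omega⟩ from Nat.zero_le _)
  simp only [conj, e1, e2]
  omega

theorem conj_conj (lam : Diagram N) : lam.conj.conj = lam := by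
  refine label_injective fun i hi => ?_
  rw [label_conj _ hi, revLabel, label_conj _ (by omega), revLabel]
  congr 1
  omega

theorem isSymmetric_iff {lam : Diagram N} : lam.IsSymmetric ↔ ∃ r : ℕ, IsRow N r lam.label := by
  constructor
  · intro h
    refine ⟨(lam.label 0).toNat, ?_, fun i hi hiN => ?_⟩
    · have := lam.label_nonneg 0
      omega
    · rw [label_eq_sub _ (by omega), h _ hi, h _ (Nat.succ_pos i)]
      rfl
  · rintro ⟨r, _, h⟩
    have key : ∀ k (hk : k < N - 1), lam.row ⟨N - 1 - k, by omega⟩ = 0 := by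
      intro k
      induction k with
      | zero =>
        intro hk
        rw [lam.last _ (by simp only; omega)]
      | succ k ih =>
        intro hk
        have h1 := ih (by omega)
        have h2 := h (N - 1 - (k + 1)) (by omega) (by omega)
        rw [label_eq_sub _ (by omega)] at h2
        have h3 : N - 1 - (k + 1) + 1 = N - 1 - k := by omega
        simp only [h3] at h2
        omega
    intro i hi
    have hi' := i.isLt
    have h3 : N - 1 - (N - 1 - i.val) = i.val := by omega
    simpa only [h3] using key (N - 1 - i) (by omega)

theorem isRow_label_conj {lam : Diagram N} (hN : 2 < N) {r : ℤ} :
    IsRow N r lam.conj.label ↔ IsRow N r (revLabel N lam.label) := by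
  unfold IsRow
  rw [label_conj _ (by omega)]
  refine and_congr_right fun _ => forall_congr' fun i => forall_congr' fun _ =>
    forall_congr' fun hi => ?_
  rw [label_conj _ hi]

theorem isConjSymmetric_iff_conj {lam : Diagram N} :
    lam.IsConjSymmetric ↔ lam.conj.IsSymmetric := by
  constructor
  · rintro ⟨mu, hmu, rfl⟩
    rwa [conj_conj]
  · intro h
    exact ⟨_, h, (conj_conj lam).symm⟩

theorem isConjSymmetric_conj {lam : Diagram N} : lam.conj.IsConjSymmetric ↔ lam.IsSymmetric := by
  rw [isConjSymmetric_iff_conj, conj_conj]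

theorem isSymOrConj_conj {lam : Diagram N} : lam.conj.IsSymOrConj ↔ lam.IsSymOrConj := by
  rw [IsSymOrConj, IsSymOrConj, isConjSymmetric_conj, isConjSymmetric_iff_conj, or_comm]

theorem isConjSymmetric_iff {lam : Diagram N} (hN : 2 < N) :
    lam.IsConjSymmetric ↔ ∃ r : ℕ, IsRow N r (revLabel N lam.label) := by
  rw [isConjSymmetric_iff_conj, isSymmetric_iff]
  exact exists_congr fun r => isRow_label_conj hN

end Diagram

/-! ### The Pieri rule -/

/-- In terms of Dynkin labels, `y` arises from `x` by adding a horizontal strip of `r` boxes, `m i` of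
them in row `i`. Full columns of length `N` are invisible to the labels. -/
def IsPieriStep (N r : ℕ) (x y : ℕ → ℤ) : Prop :=
  ∃ m, IsExponent N r m ∧ ∀ i < N - 1, y i - x i = m i - m (i + 1) ∧ m (i + 1) ≤ x i

section Pieri

variable {N : ℕ} {q : ℂˣ} {nu lam mu : Diagram N} {r : ℕ}

theorem symLabel_eq_label (h : IsRow N r mu.label) (i : Fin (N - 1)) :
    (mu.dynkin i : ℤ) = symLabel N r i := by
  rw [← Diagram.label_val, symLabel]
  split_ifs with hi
  · rw [hi, h.1]
  · exact h.2 i (Nat.pos_of_ne_zero hi) i.isLt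

theorem HasStepVector.isPieriStep (hq : ∀ n : ℕ, 0 < n → (q : ℂ) ^ n ≠ 1) (hN : 2 < N)
    {B : UqRep N q} (hB : B.IsIrrep mu) (h : HasStepVector B nu lam) (hmu : IsRow N r mu.label) :
    IsPieriStep N r lam.label nu.label := by
  obtain ⟨v, hv0, hv⟩ := hB.exists_highestWeight
  obtain ⟨b, hb0, hb⟩ := h
  rw [show (fun i => (mu.dynkin i : ℤ)) = symLabel N r from funext (symLabel_eq_label hmu)] at hv
  obtain ⟨m, hm, hmi⟩ := exists_isExponent_of_weightVector hq (by omega) hB.1.2 hv0 hv hb0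
    (fun i => (hb i).1) (fun i => (hb i).2)
  refine ⟨m, hm, fun i hi => ?_⟩
  have := hmi ⟨i, hi⟩
  simp only [← Diagram.label_val] at this
  have h2 := lam.label_val ⟨i, hi⟩
  simp only at h2
  omega

theorem HasStepVector.isPieriStep_rev (hq : ∀ n : ℕ, 0 < n → (q : ℂ) ^ n ≠ 1) (hN : 2 < N)
    {B : UqRep N q} (hB : B.IsIrrep mu) (h : HasStepVector B nu lam)
    (hmu : IsRow N r (revLabel N mu.label)) :
    IsPieriStep N r (revLabel N lam.label) (revLabel N nu.label) := by
  obtain ⟨v, hv0, hv⟩ := hB.exists_highestWeight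
  obtain ⟨b, hb0, hb⟩ := h
  have hrev : ∀ i : Fin (N - 1), (i.rev : ℕ) = N - 2 - i := fun i => by
    rw [Fin.val_rev]
    omega
  have hlab : (fun i => (mu.dynkin i : ℤ)) = fun i => symLabel N r i.rev := funext fun i => by
    have := symLabel_eq_label ((Diagram.isRow_label_conj hN).mpr hmu) i.rev
    rw [← this, ← Diagram.label_val, ← Diagram.label_val, Diagram.label_conj _ i.rev.isLt,
      revLabel, ← hrev, Fin.rev_rev]
  rw [hlab] at hv
  obtain ⟨m, hm, hmi⟩ := exists_isExponent_of_weightVector_rev hq (by omega) hB.1.2 hv0 hv hb0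
    (fun i => (hb i).1) (fun i => (hb i).2)
  refine ⟨m, hm, fun i hi => ?_⟩
  have h1 := hmi ⟨i, hi⟩
  have h2 := lam.label_val (Fin.rev ⟨i, hi⟩)
  have h3 := nu.label_val (Fin.rev ⟨i, hi⟩)
  rw [hrev] at h2 h3
  simp only [revLabel]
  simp only at h1 h2 h3
  omega

/-- The labels, reversed if `b` is false. -/
def twist (N : ℕ) (b : Bool) (x : ℕ → ℤ) : ℕ → ℤ := if b then x else revLabel N x

theorem Occurs.isPieriStep_right (hq : ∀ n : ℕ, 0 < n → (q : ℂ) ^ n ≠ 1) (hN : 2 < N)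
    (h : Occurs q nu lam mu) {b : Bool} (hmu : IsRow N r (twist N b mu.label)) :
    IsPieriStep N r (twist N b lam.label) (twist N b nu.label) := by
  obtain ⟨B, hB, hs⟩ := h.exists_stepVector_right hq
  cases b with
  | true => exact hs.isPieriStep hq hN hB hmu
  | false => exact hs.isPieriStep_rev hq hN hB hmu

theorem Occurs.isPieriStep_left (hq : ∀ n : ℕ, 0 < n → (q : ℂ) ^ n ≠ 1) (hN : 2 < N)
    (h : Occurs q nu lam mu) {b : Bool} (hlam : IsRow N r (twist N b lam.label)) :
    IsPieriStep N r (twist N b mu.label) (twist N b nu.label) := by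
  obtain ⟨B, hB, hs⟩ := h.exists_stepVector_left hq
  cases b with
  | true => exact hs.isPieriStep hq hN hB hlam
  | false => exact hs.isPieriStep_rev hq hN hB hlam

end Pieri

/-! ### Shapes of intermediate diagrams -/

section Shapes

variable {N : ℕ}

/-- The labels of a diagram with at most two rows and `s` boxes. -/
def IsTwoRow (N : ℕ) (s : ℤ) (x : ℕ → ℤ) : Prop :=
  x 0 + 2 * x 1 = s ∧ ∀ i, 2 ≤ i → i < N - 1 → x i = 0

/-- The labels of a component of `[a] ⊗ [b]*` with `a - b = s`. -/
def IsMixed (N : ℕ) (s : ℤ) (x : ℕ → ℤ) : Prop :=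
  x 0 - x (N - 2) = s ∧ ∀ i, 0 < i → i < N - 2 → x i = 0

theorem IsExponent.add_eq {r : ℕ} {m : ℕ → ℤ} (h : IsExponent N r m) {a b : ℕ} (hab : a ≠ b)
    (ha : a < N) (hb : b < N) (h0 : ∀ k < N, k ≠ a → k ≠ b → m k = 0) : m a + m b = r := by
  rw [← h.2.2, Finset.sum_eq_add a b hab]
  · intro c hc hne
    exact h0 c (Finset.mem_range.mp hc) hne.1 hne.2
  · intro h
    exact absurd (Finset.mem_range.mpr ha) h
  · intro h
    exact absurd (Finset.mem_range.mpr hb) h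

variable {r : ℕ} {s : ℤ} {x y : ℕ → ℤ}

theorem IsPieriStep.isTwoRow (hN : 2 < N) (h : IsPieriStep N r x y) (hx : IsRow N s x) :
    IsTwoRow N (r + s) y := by
  obtain ⟨m, hm, hxy⟩ := h
  have hz : ∀ k, 2 ≤ k → k < N → m k = 0 := fun k hk hkN => by
    have h1 := (hxy (k - 1) (by omega)).2
    rw [hx.2 (k - 1) (by omega) (by omega), Nat.sub_add_cancel (by omega)] at h1
    exact le_antisymm h1 (hm.1 k)
  have hs := hm.add_eq (a := 0) (b := 1) (by omega) (by omega) (by omega)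
    fun k hk h0 h1 => hz k (by omega) hk
  have h0 := (hxy 0 (by omega)).1
  have h1 := (hxy 1 (by omega)).1
  rw [hx.1] at h0
  rw [hx.2 1 (by omega) (by omega), hz 2 (by omega) (by omega)] at h1
  rw [zero_add] at h0
  refine ⟨by omega, fun i hi hiN => ?_⟩
  have h2 := (hxy i hiN).1
  rw [hx.2 i (by omega) hiN, hz i hi (by omega), hz (i + 1) (by omega) (by omega)] at h2
  omega

theorem IsPieriStep.isMixed (hN : 2 < N) (h : IsPieriStep N r x y)
    (hx : IsRow N s (revLabel N x)) : IsMixed N (r - s) y := by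
  obtain ⟨m, hm, hxy⟩ := h
  obtain ⟨hx0, hx1⟩ := hx
  have hx2 : ∀ i < N - 2, x i = 0 := fun i hi => by
    have := hx1 (N - 2 - i) (by omega) (by omega)
    rwa [revLabel, show N - 2 - (N - 2 - i) = i by omega] at this
  rw [revLabel, Nat.sub_zero] at hx0
  have hz : ∀ k, 1 ≤ k → k < N - 1 → m k = 0 := fun k hk hkN => by
    have h1 := (hxy (k - 1) (by omega)).2
    rw [hx2 (k - 1) (by omega), Nat.sub_add_cancel hk] at h1
    exact le_antisymm h1 (hm.1 k)
  have hs := hm.add_eq (a := 0) (b := N - 1) (by omega) (by omega) (by omega)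
    fun k hk h0 h1 => hz k (by omega) (by omega)
  have h0 := (hxy 0 (by omega)).1
  have h1 := (hxy (N - 2) (by omega)).1
  rw [hx2 0 (by omega), zero_add, hz 1 (by omega) (by omega)] at h0
  rw [hx0, hz (N - 2) (by omega) (by omega), show N - 2 + 1 = N - 1 by omega] at h1
  refine ⟨by omega, fun i hi hiN => ?_⟩
  have h2 := (hxy i (by omega)).1
  rw [hx2 i hiN, hz i hi (by omega), hz (i + 1) (by omega) (by omega)] at h2
  omega

theorem IsPieriStep.isMixed_of_isRow (hN : 2 < N) (h : IsPieriStep N r x y) (hy : IsRow N s y) :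
    IsMixed N (s - r) x := by
  obtain ⟨m, hm, hxy⟩ := h
  have hz : ∀ k, 1 ≤ k → k < N - 1 → m k = 0 := fun k hk hkN => by
    have h1 := hxy k (by omega)
    rw [hy.2 k (by omega) (by omega)] at h1
    have := hm.1 k
    omega
  have hs := hm.add_eq (a := 0) (b := N - 1) (by omega) (by omega) (by omega)
    fun k hk h0 h1 => hz k (by omega) (by omega)
  have h0 := (hxy 0 (by omega)).1
  have h1 := (hxy (N - 2) (by omega)).1
  rw [hy.1, zero_add, hz 1 (by omega) (by omega)] at h0
  rw [hy.2 (N - 2) (by omega) (by omega), hz (N - 2) (by omega) (by omega),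
    show N - 2 + 1 = N - 1 by omega] at h1
  refine ⟨by omega, fun i hi hiN => ?_⟩
  have h2 := (hxy i (by omega)).1
  rw [hy.2 i hi (by omega), hz i hi (by omega), hz (i + 1) (by omega) (by omega)] at h2
  omega

theorem IsPieriStep.isTwoRow_of_isRow_rev (hN : 2 < N) (h : IsPieriStep N r x y)
    (hy : IsRow N s (revLabel N y)) : IsTwoRow N (r + s) (revLabel N x) := by
  obtain ⟨m, hm, hxy⟩ := h
  obtain ⟨hy0, hy1⟩ := hy
  have hy2 : ∀ i < N - 2, y i = 0 := fun i hi => by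
    have := hy1 (N - 2 - i) (by omega) (by omega)
    rwa [revLabel, show N - 2 - (N - 2 - i) = i by omega] at this
  rw [revLabel, Nat.sub_zero] at hy0
  have hz : ∀ k < N - 2, m k = 0 := fun k hk => by
    have h1 := hxy k (by omega)
    rw [hy2 k hk] at h1
    have := hm.1 k
    omega
  have hs := hm.add_eq (a := N - 2) (b := N - 1) (by omega) (by omega) (by omega)
    fun k hk h0 h1 => hz k (by omega)
  have h0 := (hxy (N - 2) (by omega)).1
  have h1 := (hxy (N - 3) (by omega)).1
  rw [hy0, show N - 2 + 1 = N - 1 by omega] at h0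
  rw [hy2 (N - 3) (by omega), hz (N - 3) (by omega), show N - 3 + 1 = N - 2 by omega] at h1
  have e0 : revLabel N x 0 = x (N - 2) := rfl
  have e1 : revLabel N x 1 = x (N - 3) := rfl
  refine ⟨by omega, fun i hi hiN => ?_⟩
  have h2 := (hxy (N - 2 - i) (by omega)).1
  rw [hy2 _ (by omega), hz _ (by omega), hz (N - 2 - i + 1) (by omega)] at h2
  simp only [revLabel]
  omega

theorem revLabel_revLabel {i : ℕ} (hi : i < N - 1) : revLabel N (revLabel N x) i = x i := by
  rw [revLabel, revLabel]
  congr 1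
  omega

theorem isRow_revLabel_revLabel (hN : 2 < N) :
    IsRow N s (revLabel N (revLabel N x)) ↔ IsRow N s x := by
  unfold IsRow
  rw [revLabel_revLabel (by omega)]
  refine and_congr_right fun _ => forall_congr' fun i => forall_congr' fun _ =>
    forall_congr' fun hi => ?_
  rw [revLabel_revLabel hi]

theorem IsTwoRow.of_revLabel_revLabel (hN : 2 < N) (h : IsTwoRow N s (revLabel N (revLabel N x))) :
    IsTwoRow N s x := by
  unfold IsTwoRow at h
  rw [revLabel_revLabel (by omega), revLabel_revLabel (by omega)] at h
  exact ⟨h.1, fun i hi hiN => by rw [← h.2 i hi hiN, revLabel_revLabel hiN]⟩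

theorem IsMixed.of_revLabel (hN : 2 < N) (h : IsMixed N s (revLabel N x)) : IsMixed N (-s) x := by
  obtain ⟨h0, h1⟩ := h
  rw [revLabel, revLabel, Nat.sub_zero, Nat.sub_self] at h0
  refine ⟨by omega, fun i hi hiN => ?_⟩
  have := h1 (N - 2 - i) (by omega) (by omega)
  rwa [revLabel, show N - 2 - (N - 2 - i) = i by omega] at this

/-- The three families in which a diagram can lie that occurs in, or is completed by, a tensor
product of symmetric representations and their duals. -/
inductive ShapeKind
  | twoRow
  | twoRowDual
  | mixed
  deriving DecidableEq

/-- The labels `x` lie in the family `k`, with size parameter `s`. -/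
def HasShape (N : ℕ) (k : ShapeKind) (s : ℤ) (x : ℕ → ℤ) : Prop :=
  match k with
  | .twoRow => IsTwoRow N s x
  | .twoRowDual => IsTwoRow N s (revLabel N x)
  | .mixed => IsMixed N s x

theorem IsTwoRow.eq_of_dual (hN : 2 < N) {s' : ℤ} (hx : IsTwoRow N s x) (hy : IsTwoRow N s y)
    (hx' : IsTwoRow N s' (revLabel N x)) (hy' : IsTwoRow N s' (revLabel N y)) :
    ∀ i < N - 1, x i = y i := by
  intro i hi
  obtain ⟨hx0, hx1⟩ := hx
  obtain ⟨hy0, hy1⟩ := hy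
  obtain ⟨hx0', hx1'⟩ := hx'
  obtain ⟨hy0', hy1'⟩ := hy'
  have fx := fun h => hx1' (N - 2 - i) h (by omega)
  have fy := fun h => hy1' (N - 2 - i) h (by omega)
  have gx := fun h => hx1' (N - 2) h (by omega)
  have gy := fun h => hy1' (N - 2) h (by omega)
  simp only [revLabel, show N - 2 - (N - 2 - i) = i by omega, Nat.sub_self, Nat.sub_zero]
    at hx0' hy0' fx fy gx gy
  rcases Nat.lt_or_ge i 2 with h2 | h2
  -- two independent equations if `N = 3`; only `x 1` survives if `N = 4`, and nothing if `N > 4`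
  · by_cases h3 : N = 3
    · subst h3
      simp only [Nat.reduceSub] at hx0' hy0'
      obtain rfl | rfl : i = 0 ∨ i = 1 := by omega
      · omega
      · omega
    · by_cases h4 : N = 4
      · subst h4
        have a1 := gx (by omega)
        have a2 := gy (by omega)
        obtain rfl | rfl : i = 0 ∨ i = 1 := by omega
        · omega
        · omega
      · rw [fx (by omega), fy (by omega)]
  · rw [hx1 i h2 hi, hy1 i h2 hi]

theorem IsTwoRow.eq_of_isMixed (hN : 2 < N) {s' : ℤ} (hx : IsTwoRow N s x) (hy : IsTwoRow N s y)
    (hx' : IsMixed N s' x) (hy' : IsMixed N s' y) : ∀ i < N - 1, x i = y i := by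
  intro i hi
  obtain ⟨hx0, hx1⟩ := hx
  obtain ⟨hy0, hy1⟩ := hy
  obtain ⟨hx0', hx1'⟩ := hx'
  obtain ⟨hy0', hy1'⟩ := hy'
  rcases Nat.lt_or_ge i 2 with h2 | h2
  -- two independent equations if `N = 3`; only `x 0` survives if `N > 3`
  · by_cases h3 : N = 3
    · subst h3
      simp only [Nat.reduceSub] at hx0' hy0'
      obtain rfl | rfl : i = 0 ∨ i = 1 := by omega
      · omega
      · omega
    · have a1 := hx1' 1 (by omega) (by omega)
      have a2 := hy1' 1 (by omega) (by omega)
      obtain rfl | rfl : i = 0 ∨ i = 1 := by omega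
      · omega
      · omega
  · rw [hx1 i h2 hi, hy1 i h2 hi]

theorem IsMixed.rev (hN : 2 < N) (h : IsMixed N s x) : IsMixed N (-s) (revLabel N x) := by
  refine IsMixed.of_revLabel hN ⟨?_, fun i hi hiN => ?_⟩
  · rw [revLabel_revLabel (by omega), revLabel_revLabel (by omega), h.1]
  · rw [revLabel_revLabel (by omega), h.2 i hi hiN]

/-- A diagram is determined by lying in two different families of shapes. -/
theorem HasShape.eq_of_ne (hN : 2 < N) {k k' : ShapeKind} (hk : k ≠ k') {s s' : ℤ}
    (hx : HasShape N k s x) (hy : HasShape N k s y) (hx' : HasShape N k' s' x)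
    (hy' : HasShape N k' s' y) : ∀ i < N - 1, x i = y i := by
  have dual : ∀ {s s' : ℤ}, IsTwoRow N s (revLabel N x) →
      IsTwoRow N s (revLabel N y) → IsMixed N s' x → IsMixed N s' y →
      ∀ i < N - 1, x i = y i := fun h1 h2 h3 h4 i hi => by
    have := h1.eq_of_isMixed hN h2 (h3.rev hN) (h4.rev hN) (N - 2 - i) (by omega)
    rwa [revLabel, revLabel, show N - 2 - (N - 2 - i) = i by omega] at this
  cases k <;> cases k'
  · exact absurd rfl hk
  · exact IsTwoRow.eq_of_dual hN hx hy hx' hy'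
  · exact IsTwoRow.eq_of_isMixed hN hx hy hx' hy'
  · exact IsTwoRow.eq_of_dual hN hx' hy' hx hy
  · exact absurd rfl hk
  · exact dual hx hy hx' hy'
  · exact IsTwoRow.eq_of_isMixed hN hx' hy' hx hy
  · exact dual hx' hy' hx hy
  · exact absurd rfl hk

/-- The shape of the components of a product of two factors with the given signs (`true` for
symmetric, `false` for conjugate to symmetric). -/
def productShape : Bool → Bool → ShapeKind
  | true, true => .twoRow
  | false, false => .twoRowDual
  | _, _ => .mixed

/-- The shape of a factor whose product with a factor of the first sign has a component of the
second sign. -/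
def quotientShape : Bool → Bool → ShapeKind
  | true, false => .twoRowDual
  | false, true => .twoRow
  | _, _ => .mixed

theorem IsPieriStep.exists_productShape (hN : 2 < N) (b b' : Bool) (r r' : ℕ) :
    ∃ s, ∀ x y, IsRow N r' (twist N b' x) → IsPieriStep N r (twist N b x) (twist N b y) →
      HasShape N (productShape b b') s y := by
  cases b <;> cases b'
  · exact ⟨_, fun x y hx h => h.isTwoRow hN hx⟩
  · exact ⟨_, fun x y hx h => (h.isMixed hN ((isRow_revLabel_revLabel hN).mpr hx)).of_revLabel hN⟩
  · exact ⟨_, fun x y hx h => h.isMixed hN hx⟩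
  · exact ⟨_, fun x y hx h => h.isTwoRow hN hx⟩

theorem IsPieriStep.exists_quotientShape (hN : 2 < N) (b b' : Bool) (r r' : ℕ) :
    ∃ s, ∀ x y, IsRow N r' (twist N b' y) → IsPieriStep N r (twist N b x) (twist N b y) →
      HasShape N (quotientShape b b') s x := by
  cases b <;> cases b'
  · exact ⟨_, fun x y hy h => (h.isMixed_of_isRow hN hy).of_revLabel hN⟩
  · exact ⟨_, fun x y hy h => (h.isTwoRow_of_isRow_rev hN
      ((isRow_revLabel_revLabel hN).mpr hy)).of_revLabel_revLabel hN⟩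
  · exact ⟨_, fun x y hy h => h.isTwoRow_of_isRow_rev hN hy⟩
  · exact ⟨_, fun x y hy h => h.isMixed_of_isRow hN hy⟩

end Shapes

/-! ### Triviality -/

section Trivial

variable {N : ℕ} {q : ℂˣ}

/-- `lam` is symmetric (for the sign `true`) or conjugate to symmetric (for `false`). -/
def Diagram.HasSign (b : Bool) (lam : Diagram N) : Prop :=
  if b then lam.IsSymmetric else lam.IsConjSymmetric

theorem Diagram.HasSign.exists_isRow (hN : 2 < N) {b : Bool} {lam : Diagram N}
    (h : lam.HasSign b) : ∃ r : ℕ, IsRow N r (twist N b lam.label) := by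
  cases b
  · exact (isConjSymmetric_iff hN).mp h
  · exact isSymmetric_iff.mp h

theorem exists_productShape (hq : ∀ n : ℕ, 0 < n → (q : ℂ) ^ n ≠ 1) (hN : 2 < N) {b b' : Bool}
    {lam mu : Diagram N} (h : lam.HasSign b) (h' : mu.HasSign b') :
    ∃ s, ∀ nu, Occurs q nu lam mu → HasShape N (productShape b b') s nu.label := by
  obtain ⟨r, hr⟩ := h.exists_isRow hN
  obtain ⟨r', hr'⟩ := h'.exists_isRow hN
  obtain ⟨s, hs⟩ := IsPieriStep.exists_productShape hN b b' r r'
  exact ⟨s, fun nu hnu => hs _ _ hr' (hnu.isPieriStep_left hq hN hr)⟩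

theorem exists_quotientShape_right (hq : ∀ n : ℕ, 0 < n → (q : ℂ) ^ n ≠ 1) (hN : 2 < N)
    {b b' : Bool} {mu nu : Diagram N} (h : mu.HasSign b) (h' : nu.HasSign b') :
    ∃ s, ∀ lam, Occurs q nu lam mu → HasShape N (quotientShape b b') s lam.label := by
  obtain ⟨r, hr⟩ := h.exists_isRow hN
  obtain ⟨r', hr'⟩ := h'.exists_isRow hN
  obtain ⟨s, hs⟩ := IsPieriStep.exists_quotientShape hN b b' r r'
  exact ⟨s, fun lam hl => hs _ _ hr' (hl.isPieriStep_right hq hN hr)⟩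

theorem exists_quotientShape_left (hq : ∀ n : ℕ, 0 < n → (q : ℂ) ^ n ≠ 1) (hN : 2 < N)
    {b b' : Bool} {lam nu : Diagram N} (h : lam.HasSign b) (h' : nu.HasSign b') :
    ∃ s, ∀ mu, Occurs q nu lam mu → HasShape N (quotientShape b b') s mu.label := by
  obtain ⟨r, hr⟩ := h.exists_isRow hN
  obtain ⟨r', hr'⟩ := h'.exists_isRow hN
  obtain ⟨s, hs⟩ := IsPieriStep.exists_quotientShape hN b b' r r'
  exact ⟨s, fun mu hm => hs _ _ hr' (hm.isPieriStep_left hq hN hr)⟩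

theorem SixJ.isTrivial_of_shape_ne (hq : ∀ n : ℕ, 0 < n → (q : ℂ) ^ n ≠ 1) (hN : 2 < N)
    {b₁ b₂ b₃ b₄ : Bool} {s : SixJ N} (hs : s.Exists q) (h₁ : s.R₁.HasSign b₁)
    (h₂ : s.R₂.HasSign b₂) (h₃ : s.R₃.HasSign b₃) (h₄ : s.R₄.HasSign b₄)
    (hX : productShape b₁ b₂ ≠ quotientShape b₃ b₄)
    (hY : productShape b₂ b₃ ≠ quotientShape b₁ b₄) : s.IsTrivial q := by
  rintro X' Y' ⟨h1, h2, h3, h4⟩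
  obtain ⟨g1, g2, g3, g4⟩ := hs
  obtain ⟨s1, hs1⟩ := exists_productShape hq hN h₁ h₂
  obtain ⟨s2, hs2⟩ := exists_quotientShape_right hq hN h₃ h₄
  obtain ⟨s3, hs3⟩ := exists_quotientShape_left hq hN h₁ h₄
  obtain ⟨s4, hs4⟩ := exists_productShape hq hN h₂ h₃
  exact ⟨Diagram.label_injective (HasShape.eq_of_ne hN hX (hs1 _ h1) (hs1 _ g1) (hs2 _ h2)
      (hs2 _ g2)),
    Diagram.label_injective (HasShape.eq_of_ne hN hY (hs4 _ h4) (hs4 _ g4) (hs3 _ h3)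
      (hs3 _ g3))⟩

theorem Diagram.hasSign_conj {b : Bool} {lam : Diagram N} :
    lam.conj.HasSign b ↔ lam.HasSign (!b) := by
  cases b
  · exact isConjSymmetric_conj
  · exact isConjSymmetric_iff_conj.symm

theorem Diagram.IsSymOrConj.exists_hasSign {lam : Diagram N} (h : lam.IsSymOrConj) :
    ∃ b, lam.HasSign b :=
  h.elim (fun h => ⟨true, h⟩) fun h => ⟨false, h⟩

open SixJ in
/-- The signs decide: either the two shapes of each intermediate diagram differ, or the array is of
type I or II up to conjugation and the exchange of `R₁` and `R₃`. -/
theorem isTrivial_or_exists_related (hq : ∀ n : ℕ, 0 < n → (q : ℂ) ^ n ≠ 1) (hN : 2 < N)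
    {s : SixJ N} (hs : s.Exists q) (h : s.HasSymmetricEntries) :
    s.IsTrivial q ∨ ∃ t : SixJ N, s.Related t ∧ (t.IsTypeI ∨ t.IsTypeII) := by
  obtain ⟨h₁, h₂, h₃, h₄⟩ := h
  obtain ⟨b₁, h₁⟩ := h₁.exists_hasSign
  obtain ⟨b₂, h₂⟩ := h₂.exists_hasSign
  obtain ⟨b₃, h₃⟩ := h₃.exists_hasSign
  obtain ⟨b₄, h₄⟩ := h₄.exists_hasSign
  by_cases hd : productShape b₁ b₂ ≠ quotientShape b₃ b₄ ∧ productShape b₂ b₃ ≠ quotientShape b₁ b₄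
  · exact Or.inl (isTrivial_of_shape_ne hq hN hs h₁ h₂ h₃ h₄ hd.1 hd.2)
  refine Or.inr ?_
  have hc : s.Related s.conj := Relation.EqvGen.rel _ _ (Or.inr rfl)
  have hr : s.Related ⟨s.R₃.conj, s.R₂.conj, s.Y.conj, s.R₁.conj, s.R₄.conj, s.X.conj⟩ :=
    Relation.EqvGen.rel _ _ (Or.inl (Tetra.rows13 ..))
  have hrc := hr.trans _ _ _ (Relation.EqvGen.rel _ _ (Or.inr rfl))
  -- the patterns of signs for which the two shapes of `X` or those of `Y` coincide
  have key : (b₁, b₂, b₃, b₄) ∈ [(true, false, true, true), (false, true, false, false),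
      (true, true, false, true), (false, false, true, false), (true, false, false, false),
      (false, true, true, true)] := by
    revert hd
    clear * -
    revert b₁ b₂ b₃ b₄
    decide
  have conj_mem : ∀ {b : Bool} {lam : Diagram N}, lam.HasSign b → lam.conj.HasSign !b :=
    fun hl => Diagram.hasSign_conj.mpr (by rwa [Bool.not_not])
  have conj_conj_mem : ∀ {b : Bool} {lam : Diagram N}, lam.HasSign b → lam.conj.conj.HasSign b :=
    fun hl => by rwa [Diagram.conj_conj]
  simp only [List.mem_cons, Prod.mk.injEq, List.not_mem_nil, or_false] at key
  obtain ⟨rfl, rfl, rfl, rfl⟩ | ⟨rfl, rfl, rfl, rfl⟩ | ⟨rfl, rfl, rfl, rfl⟩ |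
    ⟨rfl, rfl, rfl, rfl⟩ | ⟨rfl, rfl, rfl, rfl⟩ | ⟨rfl, rfl, rfl, rfl⟩ := key
  · exact ⟨s, Relation.EqvGen.refl _, Or.inl ⟨h₁, h₂, h₃, h₄⟩⟩
  · exact ⟨_, hc, Or.inl ⟨conj_mem h₁, conj_mem h₂, conj_mem h₃, conj_mem h₄⟩⟩
  · exact ⟨s, Relation.EqvGen.refl _, Or.inr ⟨h₁, h₂, h₃, h₄⟩⟩
  · exact ⟨_, hc, Or.inr ⟨conj_mem h₁, conj_mem h₂, conj_mem h₃, conj_mem h₄⟩⟩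
  · exact ⟨_, hr, Or.inr ⟨conj_mem h₃, conj_mem h₂, conj_mem h₁, conj_mem h₄⟩⟩
  · exact ⟨_, hrc, Or.inr ⟨conj_conj_mem h₃, conj_conj_mem h₂, conj_conj_mem h₁,
      conj_conj_mem h₄⟩⟩

end Trivial

/-! ### Empty entries -/

section Empty

variable {N : ℕ} {q : ℂˣ}

theorem Diagram.isRow_zero_of_symmetric_of_conjSymmetric (hN : 2 < N) {lam : Diagram N}
    (h : lam.IsSymmetric) (h' : lam.IsConjSymmetric) : IsRow N 0 lam.label := by
  obtain ⟨r, hr⟩ := isSymmetric_iff.mp h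
  obtain ⟨r', hr'⟩ := (isConjSymmetric_iff hN).mp h'
  refine ⟨?_, hr.2⟩
  have := hr'.2 (N - 2) (by omega) (by omega)
  rwa [revLabel, Nat.sub_self] at this

theorem IsPieriStep.eq_of_zero {x y : ℕ → ℤ} (h : IsPieriStep N 0 x y) : ∀ i < N - 1, y i = x i := by
  obtain ⟨m, ⟨h1, h2, h3⟩, hm⟩ := h
  have hz : ∀ k, m k = 0 := fun k => by
    by_cases hk : k < N
    · exact (Finset.sum_eq_zero_iff_of_nonneg fun i _ => h1 i).mp (by simpa using h3) k
        (Finset.mem_range.mpr hk)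
    · exact h2 k (by omega)
  intro i hi
  have := (hm i hi).1
  rw [hz, hz] at this
  omega

theorem Occurs.eq_of_left_empty (hq : ∀ n : ℕ, 0 < n → (q : ℂ) ^ n ≠ 1) (hN : 2 < N)
    {nu lam mu : Diagram N} (h : Occurs q nu lam mu) (h0 : IsRow N 0 lam.label) : nu = mu :=
  Diagram.label_injective (h.isPieriStep_left hq hN (r := 0) (b := true) h0).eq_of_zero

theorem Occurs.eq_of_right_empty (hq : ∀ n : ℕ, 0 < n → (q : ℂ) ^ n ≠ 1) (hN : 2 < N)
    {nu lam mu : Diagram N} (h : Occurs q nu lam mu) (h0 : IsRow N 0 mu.label) : nu = lam :=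
  Diagram.label_injective (h.isPieriStep_right hq hN (r := 0) (b := true) h0).eq_of_zero

/-- If adding a horizontal strip gives full columns only, the original diagram is dual to a row. -/
theorem IsPieriStep.isRow_revLabel {x y : ℕ → ℤ} {r : ℕ} (hN : 2 < N) (h : IsPieriStep N r x y)
    (hy : ∀ i < N - 1, y i = 0) : IsRow N r (revLabel N x) := by
  have h1 := h.isMixed_of_isRow hN (s := 0) ⟨hy 0 (by omega), fun i _ hi => hy i hi⟩
  have h2 := h.isTwoRow_of_isRow_rev hN (s := 0)
    ⟨hy _ (by omega), fun i _ hi => hy _ (by omega)⟩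
  obtain ⟨a1, a2⟩ := h1
  obtain ⟨c1, c2⟩ := h2
  have e0 : revLabel N x 0 = x (N - 2) := rfl
  have e1 : revLabel N x 1 = x (N - 3) := rfl
  have e2 : revLabel N x (N - 2) = x 0 := by rw [revLabel, Nat.sub_self]
  -- the label next to the last one is `x 0` if `N = 3`, and it vanishes by `a2` otherwise
  have hz : x (N - 3) = 0 := by
    by_cases h3 : N = 3
    · subst h3
      simp only [Nat.reduceSub] at a1 e0 e1 ⊢
      omega
    · exact a2 _ (by omega) (by omega)
  refine ⟨by omega, fun i hi hiN => ?_⟩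
  by_cases h1 : i = 1
  · rw [h1, e1, hz]
  · exact c2 i (by omega) hiN

theorem Diagram.isSymOrConj_of_twist (hN : 2 < N) {lam : Diagram N} {b : Bool} {r : ℕ}
    (h : IsRow N r (revLabel N (twist N b lam.label))) : lam.IsSymOrConj := by
  cases b
  · exact Or.inl (isSymmetric_iff.mpr ⟨r, (isRow_revLabel_revLabel hN).mp h⟩)
  · exact Or.inr ((isConjSymmetric_iff hN).mpr ⟨r, h⟩)

theorem twist_eq_zero (hN : 2 < N) {x : ℕ → ℤ} (h : IsRow N 0 x) (b : Bool) :
    ∀ i < N - 1, twist N b x i = 0 := by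
  have hz : ∀ i < N - 1, x i = 0 := fun i hi => by
    rcases Nat.eq_zero_or_pos i with rfl | h0
    · exact h.1
    · exact h.2 i h0 hi
  intro i hi
  cases b
  · exact hz _ (by omega)
  · exact hz i hi

/-- If the trivial representation occurs in a product with a symmetric or conjugate right factor, the
left factor is its dual. -/
theorem Occurs.isSymOrConj_left_of_empty (hq : ∀ n : ℕ, 0 < n → (q : ℂ) ^ n ≠ 1) (hN : 2 < N)
    {nu lam mu : Diagram N} (h : Occurs q nu lam mu) (h0 : IsRow N 0 nu.label)
    (hmu : mu.IsSymOrConj) : lam.IsSymOrConj := by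
  obtain ⟨b, hb⟩ := hmu.exists_hasSign
  obtain ⟨r, hr⟩ := hb.exists_isRow hN
  exact Diagram.isSymOrConj_of_twist hN
    ((h.isPieriStep_right hq hN hr).isRow_revLabel hN (twist_eq_zero hN h0 b))

theorem Occurs.isSymOrConj_right_of_empty (hq : ∀ n : ℕ, 0 < n → (q : ℂ) ^ n ≠ 1) (hN : 2 < N)
    {nu lam mu : Diagram N} (h : Occurs q nu lam mu) (h0 : IsRow N 0 nu.label)
    (hlam : lam.IsSymOrConj) : mu.IsSymOrConj := by
  obtain ⟨b, hb⟩ := hlam.exists_hasSign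
  obtain ⟨r, hr⟩ := hb.exists_isRow hN
  exact Diagram.isSymOrConj_of_twist hN
    ((h.isPieriStep_left hq hN hr).isRow_revLabel hN (twist_eq_zero hN h0 b))

/-- If one of `R₁, …, R₄` is empty, then `X` and `Y` are symmetric or conjugate to symmetric. -/
theorem SixJ.isSymOrConj_of_empty (hq : ∀ n : ℕ, 0 < n → (q : ℂ) ^ n ≠ 1) (hN : 2 < N)
    {s : SixJ N} (hs : s.Exists q) (h : s.HasSymmetricEntries)
    (h0 : IsRow N 0 s.R₁.label ∨ IsRow N 0 s.R₂.label ∨ IsRow N 0 s.R₃.label ∨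
      IsRow N 0 s.R₄.label) : s.X.IsSymOrConj ∧ s.Y.IsSymOrConj := by
  obtain ⟨g1, g2, g3, g4⟩ := hs
  obtain ⟨h1, h2, h3, h4⟩ := h
  rcases h0 with h0 | h0 | h0 | h0
  · exact ⟨g1.eq_of_left_empty hq hN h0 ▸ h2, g3.eq_of_left_empty hq hN h0 ▸ h4⟩
  · exact ⟨g1.eq_of_right_empty hq hN h0 ▸ h1, g4.eq_of_left_empty hq hN h0 ▸ h3⟩
  · exact ⟨g2.eq_of_right_empty hq hN h0 ▸ h4, g4.eq_of_right_empty hq hN h0 ▸ h2⟩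
  · exact ⟨g2.isSymOrConj_left_of_empty hq hN h0 h3, g3.isSymOrConj_right_of_empty hq hN h0 h1⟩

end Empty

/-! ### Invariants of the symmetries -/

section Invariants

variable {N : ℕ}

/-- `lam` is symmetric but not conjugate to symmetric (for the sign `true`), or the other way round
(for `false`). -/
def Diagram.HasProperSign (b : Bool) (lam : Diagram N) : Prop :=
  lam.HasSign b ∧ ¬ lam.HasSign (!b)

theorem Diagram.hasProperSign_conj {b : Bool} {lam : Diagram N} :
    lam.conj.HasProperSign b ↔ lam.HasProperSign (!b) := by
  rw [HasProperSign, HasProperSign, hasSign_conj, hasSign_conj]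

namespace SixJ

/-- Some pair of opposite entries is not symmetric up to conjugation, and the signs of the four other
entries alternate along the cycle that they form. In the three cases this cycle is
`R₁, R₂, R₃, R₄*`, then `R₁, X*, R₃*, Y`, then `R₂, X*, R₄, Y*`. -/
def Alternates (s : SixJ N) : Prop :=
  (∃ b, s.R₁.HasProperSign b ∧ s.R₂.HasProperSign (!b) ∧ s.R₃.HasProperSign b ∧
    s.R₄.HasProperSign b ∧ ¬ (s.X.IsSymOrConj ∧ s.Y.IsSymOrConj)) ∨
  (∃ b, s.R₁.HasProperSign b ∧ s.X.HasProperSign b ∧ s.R₃.HasProperSign (!b) ∧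
    s.Y.HasProperSign (!b) ∧ ¬ (s.R₂.IsSymOrConj ∧ s.R₄.IsSymOrConj)) ∨
  (∃ b, s.R₂.HasProperSign b ∧ s.X.HasProperSign b ∧ s.R₄.HasProperSign b ∧
    s.Y.HasProperSign b ∧ ¬ (s.R₁.IsSymOrConj ∧ s.R₃.IsSymOrConj))

/-- Some pair of opposite entries is not symmetric up to conjugation, and in the cycle of the four
other entries, as in `Alternates`, opposite ones have different signs. -/
def Opposes (s : SixJ N) : Prop :=
  (∃ b c, s.R₁.HasProperSign b ∧ s.R₂.HasProperSign c ∧ s.R₃.HasProperSign (!b) ∧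
    s.R₄.HasProperSign c ∧ ¬ (s.X.IsSymOrConj ∧ s.Y.IsSymOrConj)) ∨
  (∃ b c, s.R₁.HasProperSign b ∧ s.X.HasProperSign c ∧ s.R₃.HasProperSign b ∧
    s.Y.HasProperSign c ∧ ¬ (s.R₂.IsSymOrConj ∧ s.R₄.IsSymOrConj)) ∨
  (∃ b c, s.R₂.HasProperSign b ∧ s.X.HasProperSign c ∧ s.R₄.HasProperSign (!b) ∧
    s.Y.HasProperSign (!c) ∧ ¬ (s.R₁.IsSymOrConj ∧ s.R₃.IsSymOrConj))

theorem Tetra.symm {s t : SixJ N} (h : Tetra s t) : Tetra t s := by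
  cases h with
  | rows13 a b m c d n =>
    simpa only [Diagram.conj_conj] using Tetra.rows13 c.conj b.conj n.conj a.conj d.conj m.conj
  | rows12 a b m c d n =>
    simpa only [Diagram.conj_conj] using Tetra.rows12 c d.conj m.conj a b.conj n.conj
  | cols23 a b m c d n =>
    simpa only [Diagram.conj_conj] using Tetra.cols23 a m.conj b.conj c.conj n.conj d.conj
  | cols12 a b m c d n =>
    simpa only [Diagram.conj_conj] using Tetra.cols12 b a m d.conj c.conj n.conj

theorem conj_conj (s : SixJ N) : s.conj.conj = s := by
  cases s
  simp only [conj, Diagram.conj_conj]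

/-- A property preserved by the basic symmetries and by conjugation is an invariant, since all of
these are involutions. -/
theorem Related.iff_of_preserved {P : SixJ N → Prop} (hT : ∀ s t, Tetra s t → P s → P t)
    (hc : ∀ s, P s → P s.conj) {s t : SixJ N} (h : s.Related t) : P s ↔ P t := by
  induction h with
  | rel s t h =>
    rcases h with h | rfl
    · exact ⟨hT s t h, hT t s h.symm⟩
    · exact ⟨hc s, fun h => s.conj_conj ▸ hc _ h⟩
  | refl s => exact Iff.rfl
  | symm s t _ ih => exact ih.symm
  | trans s t u _ _ ih1 ih2 => exact ih1.trans ih2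

theorem Alternates.tetra {s t : SixJ N} (h : Tetra s t) (hs : s.Alternates) : t.Alternates := by
  cases h <;> simp only [Alternates, Diagram.hasProperSign_conj, Diagram.isSymOrConj_conj]
    at hs ⊢ <;>
  rcases hs with ⟨b, hs⟩ | ⟨b, hs⟩ | ⟨b, hs⟩
  all_goals
    first
    | exact Or.inl ⟨b, by grind⟩
    | exact Or.inl ⟨!b, by grind⟩
    | exact Or.inr (Or.inl ⟨b, by grind⟩)
    | exact Or.inr (Or.inl ⟨!b, by grind⟩)
    | exact Or.inr (Or.inr ⟨b, by grind⟩)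
    | exact Or.inr (Or.inr ⟨!b, by grind⟩)

theorem Alternates.conj {s : SixJ N} (hs : s.Alternates) : s.conj.Alternates := by
  simp only [Alternates, SixJ.conj, Diagram.hasProperSign_conj, Diagram.isSymOrConj_conj]
    at hs ⊢
  rcases hs with ⟨b, hs⟩ | ⟨b, hs⟩ | ⟨b, hs⟩
  · exact Or.inl ⟨!b, by grind⟩
  · exact Or.inr (Or.inl ⟨!b, by grind⟩)
  · exact Or.inr (Or.inr ⟨!b, by grind⟩)

theorem Opposes.tetra {s t : SixJ N} (h : Tetra s t) (hs : s.Opposes) : t.Opposes := by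
  cases h <;> simp only [Opposes, Diagram.hasProperSign_conj, Diagram.isSymOrConj_conj]
    at hs ⊢ <;>
  rcases hs with ⟨b, c, hs⟩ | ⟨b, c, hs⟩ | ⟨b, c, hs⟩
  all_goals
    first
    | exact Or.inl ⟨b, !c, by grind⟩
    | exact Or.inl ⟨!b, !c, by grind⟩
    | exact Or.inl ⟨c, b, by grind⟩
    | exact Or.inr (Or.inl ⟨b, c, by grind⟩)
    | exact Or.inr (Or.inl ⟨b, !c, by grind⟩)
    | exact Or.inr (Or.inl ⟨!b, !c, by grind⟩)
    | exact Or.inr (Or.inr ⟨b, c, by grind⟩)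
    | exact Or.inr (Or.inr ⟨b, !c, by grind⟩)
    | exact Or.inr (Or.inr ⟨!b, c, by grind⟩)
    | exact Or.inr (Or.inr ⟨!c, !b, by grind⟩)

theorem Opposes.conj {s : SixJ N} (hs : s.Opposes) : s.conj.Opposes := by
  simp only [Opposes, SixJ.conj, Diagram.hasProperSign_conj, Diagram.isSymOrConj_conj]
    at hs ⊢
  rcases hs with ⟨b, c, hs⟩ | ⟨b, c, hs⟩ | ⟨b, c, hs⟩
  · exact Or.inl ⟨!b, !c, by grind⟩
  · exact Or.inr (Or.inl ⟨!b, !c, by grind⟩)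
  · exact Or.inr (Or.inr ⟨!b, !c, by grind⟩)

end SixJ

end Invariants

/-- A nonsymmetric `X` or `Y` forces all `R i` to be nonempty, and then the types are told apart by the
invariants `Alternates` and `Opposes`. -/
theorem SixJ.not_related_of_types {N : ℕ} {q : ℂˣ} (hq : ∀ n : ℕ, 0 < n → (q : ℂ) ^ n ≠ 1)
    (hN : 2 < N) {s t : SixJ N} (hs : s.Exists q) (hXY : ¬ (s.X.IsSymOrConj ∧ s.Y.IsSymOrConj))
    (h : s.IsTypeI ∧ t.IsTypeII ∨ s.IsTypeII ∧ t.IsTypeI) : ¬ s.Related t := by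
  intro hst
  have hsym : s.HasSymmetricEntries := by
    rcases h with ⟨⟨h1, h2, h3, h4⟩, _⟩ | ⟨⟨h1, h2, h3, h4⟩, _⟩
    · exact ⟨Or.inl h1, Or.inr h2, Or.inl h3, Or.inl h4⟩
    · exact ⟨Or.inl h1, Or.inl h2, Or.inr h3, Or.inl h4⟩
  have hne := mt (isSymOrConj_of_empty hq hN hs hsym) hXY
  simp only [not_or] at hne
  obtain ⟨n1, n2, n3, n4⟩ := hne
  have pos : ∀ {lam : Diagram N}, ¬ IsRow N 0 lam.label → lam.IsSymmetric →
      lam.HasProperSign true := fun hn hl =>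
    ⟨hl, fun hl' => hn (Diagram.isRow_zero_of_symmetric_of_conjSymmetric hN hl hl')⟩
  have neg : ∀ {lam : Diagram N}, ¬ IsRow N 0 lam.label → lam.IsConjSymmetric →
      lam.HasProperSign false := fun hn hl =>
    ⟨hl, fun hl' => hn (Diagram.isRow_zero_of_symmetric_of_conjSymmetric hN hl' hl)⟩
  rcases h with ⟨⟨h1, h2, h3, h4⟩, ⟨k1, k2, k3, k4⟩⟩ | ⟨⟨h1, h2, h3, h4⟩, ⟨k1, k2, k3, k4⟩⟩
  · have hA : s.Alternates := Or.inl ⟨true, pos n1 h1, neg n2 h2, pos n3 h3, pos n4 h4, hXY⟩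
    rw [hst.iff_of_preserved (fun _ _ => Alternates.tetra) (fun _ => Alternates.conj)] at hA
    rcases hA with ⟨b, g1, _, g3, _⟩ | ⟨_, _, _, _, _, g⟩ | ⟨_, _, _, _, _, g⟩
    · cases b
      · exact g1.2 k1
      · exact g3.2 k3
    · exact g ⟨Or.inl k2, Or.inl k4⟩
    · exact g ⟨Or.inl k1, Or.inr k3⟩
  · have hO : s.Opposes :=
      Or.inl ⟨true, true, pos n1 h1, pos n2 h2, neg n3 h3, pos n4 h4, hXY⟩
    rw [hst.iff_of_preserved (fun _ _ => Opposes.tetra) (fun _ => Opposes.conj)] at hO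
    rcases hO with ⟨b, _, g1, _, g3, _⟩ | ⟨_, _, _, _, _, _, g⟩ | ⟨_, _, _, _, _, _, g⟩
    · cases b
      · exact g1.2 k1
      · exact g3.2 k3
    · exact g ⟨Or.inr k2, Or.inl k4⟩
    · exact g ⟨Or.inl k1, Or.inl k3⟩

theorem mainTheorem6 (N : ℕ) (hN : 2 < N) (q : ℂˣ) (hq : ∀ n : ℕ, 0 < n → (q : ℂ) ^ n ≠ 1) :
    (∀ s : SixJ N, s.Exists q → s.HasSymmetricEntries →
      s.IsTrivial q ∨ ∃ t : SixJ N, s.Related t ∧ (t.IsTypeI ∨ t.IsTypeII)) ∧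
    (∀ s t : SixJ N, s.Exists q → ¬ s.IsTrivial q → ¬ (s.X.IsSymOrConj ∧ s.Y.IsSymOrConj) →
      (s.IsTypeI ∧ t.IsTypeII ∨ s.IsTypeII ∧ t.IsTypeI) → ¬ s.Related t) :=
  ⟨fun _ hs h => isTrivial_or_exists_related hq hN hs h,
    fun _ _ hs _ hXY h => SixJ.not_related_of_types hq hN hs hXY h⟩
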